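/- Let $A,B$ be vector spaces over a field $K$ of characteristic $0$, and let $A\oplus B$ carry a quasi-twilled associative algebra structure, i.e. an associative multiplication for which $B$ is a subalgebra, written $$(a,x)(b,y)=\big(a\cdot_A b+a\leftharpoonup y+x\rightharpoonup b,\; x\cdot_B y+a\vartriangleright y+x\vartriangleleft b+\theta(a,b)\big)$$ with bilinear maps $\cdot_A,\cdot_B,\vartriangleright,\vartriangleleft,\rightharpoonup,\leftharpoonup,\theta$. A linear map $D:A\to B$ is a strong deformation map if for all $a,b\in A$ $$D\big(a\cdot_A b+a\leftharpoonup D(b)+D(a)\rightharpoonup b\big)=D(a)\cdot_B D(b)+a\vartriangleright D(b)+D(a)\vartriangleleft b+\theta(a,b).$$ Let $\mathfrak g=\bigoplus_{n\ge0}\mathrm{Hom}((A\oplus B)^{\otimes n+1},A\oplus B)$ with the Gerstenhaber bracket, where $\mathrm{Hom}((A\oplus B)^{\otimes n+1},A\oplus B)$ has degree $n$, let $\mathfrak a=\bigoplus_{n\ge0}\mathrm{Hom}(A^{\otimes n+1},B)\subset\mathfrak g$, and let $P:\mathfrak g\to\mathfrak a$ be the projection that restricts the arguments to $A$ and takes the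 $B$-component. Put $\Omega=\widetilde\theta+\mu_{\vartriangleright,\vartriangleleft}+\nu_{\rightharpoonup,\leftharpoonup}\in\mathfrak g_1$, where $$\widetilde\theta((a,x),(b,y))=(0,\theta(a,b)),\quad \mu_{\vartriangleright,\vartriangleleft}((a,x),(b,y))=(a\cdot_A b,\,a\vartriangleright y+x\vartriangleleft b),\quad \nu_{\rightharpoonup,\leftharpoonup}((a,x),(b,y))=(a\leftharpoonup y+x\rightharpoonup b,\,x\cdot_B y).$$ The operations of the controlling algebra are $l_k(f_1,\dots,f_k)=P[\cdots[[\Omega,f_1],f_2],\dots,f_k]$ for $k\ge0$ (so $l_0=P(\Omega)$). For a linear map $D:A\to B$ (an element of $\mathfrak a_0$), the twisted operations are $$l_k^D(f_1,\dots,f_k)=\sum_{n\ge0}\frac1{n!}\,l_{n+k}(D,\dots,D,f_1,\dots,f_k),\qquad k\ge 0 .$$ **Theorem.** Let $D:A\to B$ be a strong deformation map. Then: 1. $l_0=\theta$, $l_1(f)=[\mu_{\vartriangleright,\vartriangleleft},f]$, $l_2(f,g)=[[\nu_{\rightharpoonup,\leftharpoonup},f],g]$ for all $f,g\in\mathfrak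 a$, and $l_k=0$ for $k\ge3$; in particular all the sums above are finite. 2. $(\mathfrak a,\{l_k^D\})$ is an $L_\infty$-algebra: the $l_k^D$ are graded symmetric multilinear maps of degree $1$, $l_0^D=0$, and for all $N$ and homogeneous $x_1,\dots,x_N$ $$\sum_{i=0}^{N}\ \sum_{\sigma\in Sh(i,N-i)}\epsilon(\sigma)\,l^D_{N-i+1}\big(l^D_i(x_{\sigma(1)},\dots,x_{\sigma(i)}),x_{\sigma(i+1)},\dots,x_{\sigma(N)}\big)=0,$$ where $\epsilon(\sigma)$ is the Koszul sign. Moreover, for $f,g\in\mathfrak a$, $$l_1^D(f)=l_1(f)+l_2(D,f),\qquad l_2^D(f,g)=l_2(f,g),\qquad l_k^D=0\ \text{ for }k\ge3 .$$ 3. For every linear map $D':A\to B$, the sum $D+D'$ is a strong deformation map if and only if $D'\in\mathfrak a_0$ is a Maurer–Cartan element of $(\mathfrak a,\{l_k^D\})$, i.e. $\sum_{k\ge1}\frac1{k!}l_k^D(D',\dots,D')=0$. 4. For every $n\ge1$ and $f\in\mathfrak a_{n-1}=\mathrm{Hom}(A^{\otimes n},B)$, $l_1^D(f)=(-1)^{n-1}\delta^D(f)$,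 where $$\begin{aligned}\delta^D(f)(a_1,\dots,a_{n+1})={}&a_1\vartriangleright_D f(a_2,\dots,a_{n+1})+\sum_{i=1}^n(-1)^i f(a_1,\dots,a_{i-1},a_i\cdot_D a_{i+1},a_{i+2},\dots,a_{n+1})\\&+(-1)^{n+1}f(a_1,\dots,a_n)\vartriangleleft_D a_{n+1}\end{aligned}$$ is the Hochschild differential for $a\cdot_D b=a\cdot_A b+a\leftharpoonup D(b)+D(a)\rightharpoonup b$, $\;a\vartriangleright_D x=a\vartriangleright x+D(a)\cdot_B x-D(a\leftharpoonup x)$, $\;x\vartriangleleft_D a=x\vartriangleleft a+x\cdot_B D(a)-D(x\rightharpoonup a)$. -/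

import Mathlib

open scoped Nat

noncomputable section

/-! ## Curved L-infinity algebras (symmetric convention, all operations of degree one) -/

section LInfinity

/-- The Koszul sign `ε(σ)` determined by
`x_1 ⊙ ... ⊙ x_k = ε(σ) x_{σ(1)} ⊙ ... ⊙ x_{σ(k)}` for graded symmetric products of elements
`x_i` of degree `d i`: one factor `(-1)^{|x||y|}` for every pair that `σ` puts in reverse order. -/
def koszulSign {k : ℕ} (d : Fin k → ℤ) (σ : Equiv.Perm (Fin k)) : ℤˣ :=
  ∏ p : Fin k × Fin k,
    if p.1 < p.2 ∧ σ p.2 < σ p.1 then Int.negOnePow (d (σ p.1) * d (σ p.2)) else 1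

/-- `σ` is an `(i, N - i)`-shuffle: increasing on the first `i` places and on the others. -/
def IsShuffle {N : ℕ} (i : ℕ) (σ : Equiv.Perm (Fin N)) : Prop :=
  (∀ a b : Fin N, a < b → b.1 < i → σ a < σ b) ∧
  (∀ a b : Fin N, i ≤ a.1 → a < b → σ a < σ b)

variable {K : Type*} [Field K] {G : Type*} [AddCommGroup G] [Module K G]

open Classical in
/-- The left side of the `N`-th structure equation,
`∑_i ∑_{σ ∈ Sh(i, N-i)} ε(σ) l_{N-i+1}(l_i(x_{σ(1)}, ..., x_{σ(i)}), x_{σ(i+1)}, ..., x_{σ(N)})`,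
for elements `x_j` of degree `d j`. -/
def jacobiator (l : (k : ℕ) → (Fin k → G) → G) {N : ℕ} (d : Fin N → ℤ) (x : Fin N → G) : G :=
  ∑ i : Fin (N + 1), ∑ σ : Equiv.Perm (Fin N),
    if IsShuffle i.1 σ then
      koszulSign d σ •
        l (N - i.1 + 1)
          (Fin.cons (l i.1 (fun a : Fin i.1 => x (σ ⟨a.1, by omega⟩)))
            (fun b : Fin (N - i.1) => x (σ ⟨i.1 + b.1, by omega⟩)))
    else 0

/-- `(G, l)`, with `G = ⨁ 𝒢 i` a `ℤ`-graded vector space, is a curved `L_∞`-algebra. -/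
structure IsCurvedLInfty (𝒢 : ℤ → Submodule K G) (l : (k : ℕ) → (Fin k → G) → G) : Prop where
  graded : DirectSum.IsInternal 𝒢
  multilinear : ∀ k, ∃ m : MultilinearMap K (fun _ : Fin k => G) G, ∀ x, m x = l k x
  degree_one : ∀ (k : ℕ) (d : Fin k → ℤ) (x : Fin k → G),
    (∀ i, x i ∈ 𝒢 (d i)) → l k x ∈ 𝒢 (∑ i, d i + 1)
  symm : ∀ (k : ℕ) (d : Fin k → ℤ) (x : Fin k → G), (∀ i, x i ∈ 𝒢 (d i)) →
    ∀ σ : Equiv.Perm (Fin k), l k (fun i => x (σ i)) = koszulSign d σ • l k x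
  jacobi : ∀ (N : ℕ) (d : Fin N → ℤ) (x : Fin N → G), (∀ i, x i ∈ 𝒢 (d i)) →
    jacobiator l d x = 0

/-- An `L_∞`-algebra is a curved `L_∞`-algebra with `l_0 = 0`. -/
structure IsLInfty (𝒢 : ℤ → Submodule K G) (l : (k : ℕ) → (Fin k → G) → G) : Prop
    extends IsCurvedLInfty 𝒢 l where
  flat : ∀ x : Fin 0 → G, l 0 x = 0

variable (K) in
/-- The operations twisted by `α`:
`l_k^α(x_1, ..., x_k) = ∑_n (1/n!) l_{n+k}(α, ..., α, x_1, ..., x_k)`. For `k = 0` this is the left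
side of the Maurer-Cartan equation of `α`. It is used only for families `l` with finitely many
nonzero operations, where the sum is finite. -/
def twist (l : (k : ℕ) → (Fin k → G) → G) (α : G) (k : ℕ) (x : Fin k → G) : G :=
  ∑ᶠ n : ℕ, ((n ! : ℕ) : K)⁻¹ • l (n + k) (Fin.append (fun _ : Fin n => α) x)

/-- `α` is a Maurer-Cartan element: it has degree `0` and
`l_0 + ∑_{k ≥ 1} (1/k!) l_k(α, ..., α) = 0`. It is used only for families `l` with finitely many
nonzero operations, where the sum is finite. -/
def IsMaurerCartan (𝒢 : ℤ → Submodule K G) (l : (k : ℕ) → (Fin k → G) → G) (α : G) : Prop :=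
  α ∈ 𝒢 0 ∧ ∑ᶠ k : ℕ, ((k ! : ℕ) : K)⁻¹ • l k (fun _ => α) = 0

end LInfinity

/-! ## Multilinear maps and the Gerstenhaber bracket -/

section Multilinear

/-- The arguments `(v_1, ..., v_i, y, v_{i+n+2}, ..., v_{m+n})`, in which `y` stands in place of
the block of `n + 1` consecutive entries of `v` that starts at (zero-based) place `i`. -/
def insArgs {V : Type*} {m n p : ℕ} (h : p = m + n) (i : Fin m) (v : Fin p → V) (y : V) : Fin m → V :=
  Function.update
    (fun j : Fin m => if j.1 < i.1 then v ⟨j.1, by omega⟩ else v ⟨j.1 + n, by omega⟩) i y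

/-- The block of `n + 1` consecutive entries of `v` that starts at (zero-based) place `i`. -/
def insBlock {V : Type*} {m n p : ℕ} (h : p = m + n) (i : Fin m) (v : Fin p → V) : Fin (n + 1) → V :=
  fun k => v ⟨i.1 + k.1, by omega⟩

theorem ins_update_in {V : Type*} {m n p : ℕ} (h : p = m + n) (i : Fin m) (v : Fin p → V) (y x : V)
    (k : Fin (n + 1)) (q : Fin p) (hq : q.1 = i.1 + k.1) :
    insArgs h i (Function.update v q x) y = insArgs h i v y ∧
    insBlock h i (Function.update v q x) = Function.update (insBlock h i v) k x := by
  constructor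
  · funext j
    unfold insArgs
    by_cases hj : j = i
    · subst hj; simp
    · have hj' : j.1 ≠ i.1 := fun e => hj (Fin.ext e)
      rw [Function.update_of_ne hj, Function.update_of_ne hj]
      split_ifs with hlt
      · rw [Function.update_of_ne]
        intro e; have := congrArg Fin.val e; simp at this
        omega
      · rw [Function.update_of_ne]
        intro e; have := congrArg Fin.val e; simp at this
        omega
  · funext k'
    unfold insBlock
    by_cases hk : k' = k
    · subst hk
      rw [Function.update_self]
      have : (⟨i.1 + k'.1, by omega⟩ : Fin p) = q := Fin.ext hq.symm
      rw [this, Function.update_self]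
    · rw [Function.update_of_ne hk, Function.update_of_ne]
      intro e; have := congrArg Fin.val e; simp at this
      exact hk (Fin.ext (by omega))

theorem ins_update_out {V : Type*} {m n p : ℕ} (h : p = m + n) (i : Fin m) (v : Fin p → V) (y x : V)
    (j : Fin m) (hji : j ≠ i) (q : Fin p)
    (hq : q.1 = if j.1 < i.1 then j.1 else j.1 + n) :
    insArgs h i (Function.update v q x) y = Function.update (insArgs h i v y) j x ∧
    insBlock h i (Function.update v q x) = insBlock h i v := by
  have hji' : j.1 ≠ i.1 := fun e => hji (Fin.ext e)
  constructor
  · funext a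
    unfold insArgs
    by_cases ha : a = i
    · subst ha
      rw [Function.update_self, Function.update_of_ne (Ne.symm hji), Function.update_self]
    · have ha' : a.1 ≠ i.1 := fun e => ha (Fin.ext e)
      rw [Function.update_of_ne ha]
      by_cases haj : a = j
      · subst haj
        rw [Function.update_self]
        split_ifs at hq ⊢ with h1
        · have : (⟨a.1, by omega⟩ : Fin p) = q := Fin.ext hq.symm
          rw [this, Function.update_self]
        · have : (⟨a.1 + n, by omega⟩ : Fin p) = q := Fin.ext hq.symm
          rw [this, Function.update_self]
      · have haj' : a.1 ≠ j.1 := fun e => haj (Fin.ext e)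
        rw [Function.update_of_ne haj, Function.update_of_ne ha]
        split_ifs with h1
        · rw [Function.update_of_ne]
          intro e; have := congrArg Fin.val e; simp at this
          split_ifs at hq <;> omega
        · rw [Function.update_of_ne]
          intro e; have := congrArg Fin.val e; simp at this
          split_ifs at hq <;> omega
  · funext k
    unfold insBlock
    rw [Function.update_of_ne]
    intro e; have := congrArg Fin.val e; simp at this
    split_ifs at hq <;> omega

theorem ins_cases {m n p : ℕ} (h : p = m + n) (i : Fin m) (q : Fin p) :
    (∃ k : Fin (n + 1), q.1 = i.1 + k.1) ∨
    (∃ j : Fin m, j ≠ i ∧ q.1 = if j.1 < i.1 then j.1 else j.1 + n) := by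
  by_cases h1 : q.1 < i.1
  · right
    refine ⟨⟨q.1, by omega⟩, fun e => by have := congrArg Fin.val e; simp at this; omega, ?_⟩
    rw [if_pos h1]
  · by_cases h2 : q.1 ≤ i.1 + n
    · left; exact ⟨⟨q.1 - i.1, by omega⟩, by simp; omega⟩
    · right
      refine ⟨⟨q.1 - n, by omega⟩, fun e => by have := congrArg Fin.val e; simp at this; omega, ?_⟩
      rw [if_neg (by simp; omega)]
      simp; omega

variable {K : Type*} [Field K] {V W : Type*} [AddCommGroup V] [Module K V]
  [AddCommGroup W] [Module K W]

/-- Insertion of `g`, with `n + 1` arguments, into the (zero-based) place `i` of `f`: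
`(v_1, ..., v_{m+n}) ↦ f(v_1, ..., v_i, g(v_{i+1}, ..., v_{i+n+1}), v_{i+n+2}, ..., v_{m+n})`. -/
def insertMap {m n p : ℕ} (h : p = m + n) (f : MultilinearMap K (fun _ : Fin m => V) W)
    (g : MultilinearMap K (fun _ : Fin (n + 1) => V) V) (i : Fin m) :
    MultilinearMap K (fun _ : Fin p => V) W :=
  MultilinearMap.mk' (fun v => f (insArgs h i v (g (insBlock h i v))))
    (by
      intro v q x y
      rcases ins_cases h i q with ⟨k, hq⟩ | ⟨j, hj, hq⟩
      · simp only [(ins_update_in h i v _ _ k q hq).1, (ins_update_in h i v 0 _ k q hq).2,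
          MultilinearMap.map_update_add]
        simp only [insArgs, MultilinearMap.map_update_add]
      · simp only [(ins_update_out h i v _ _ j hj q hq).1, (ins_update_out h i v 0 _ j hj q hq).2,
          MultilinearMap.map_update_add])
    (by
      intro v q c x
      rcases ins_cases h i q with ⟨k, hq⟩ | ⟨j, hj, hq⟩
      · simp only [(ins_update_in h i v _ _ k q hq).1, (ins_update_in h i v 0 _ k q hq).2,
          MultilinearMap.map_update_smul]
        simp only [insArgs, MultilinearMap.map_update_smul]
      · simp only [(ins_update_out h i v _ _ j hj q hq).1, (ins_update_out h i v 0 _ j hj q hq).2,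
          MultilinearMap.map_update_smul])

theorem insertMap_apply {m n p : ℕ} (h : p = m + n) (f : MultilinearMap K (fun _ : Fin m => V) W)
    (g : MultilinearMap K (fun _ : Fin (n + 1) => V) V) (i : Fin m) (v : Fin p → V) :
    insertMap h f g i v = f (insArgs h i v (g (insBlock h i v))) := rfl

/-- Degree `n` part `Hom(V^{⊗ n+1}, W)` of the graded space of multilinear maps. -/
abbrev Cochain (K V W : Type*) [Field K] [AddCommGroup V] [Module K V]
    [AddCommGroup W] [Module K W] (n : ℕ) : Type _ :=
  MultilinearMap K (fun _ : Fin (n + 1) => V) W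

/-- The graded space `⨁_{n ≥ 0} Hom(V^{⊗ n+1}, W)`. -/
abbrev Cochains (K V W : Type*) [Field K] [AddCommGroup V] [Module K V]
    [AddCommGroup W] [Module K W] : Type _ :=
  DirectSum ℕ (Cochain K V W)

/-- `f ⋄ g = ∑_{i=0}^{m} (-1)^{i n} f(v_1, ..., v_i, g(v_{i+1}, ..., v_{i+n+1}), ...)` for `f` of
degree `m` and `g` of degree `n`, as a bilinear map. -/
def diamond (K V : Type*) [Field K] [AddCommGroup V] [Module K V] (m n : ℕ) :
    Cochain K V V m →ₗ[K] Cochain K V V n →ₗ[K] Cochain K V V (m + n) :=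
  LinearMap.mk₂ K
    (fun f g => ∑ i : Fin (m + 1), (-1 : K) ^ (i.1 * n) • insertMap (by omega) f g i)
    (by
      intro f f' g
      rw [← Finset.sum_add_distrib]
      refine Finset.sum_congr rfl fun i _ => ?_
      rw [← smul_add]; rfl)
    (by
      intro c f g
      rw [Finset.smul_sum]
      refine Finset.sum_congr rfl fun i _ => ?_
      rw [smul_comm c]; rfl)
    (by
      intro f g g'
      rw [← Finset.sum_add_distrib]
      refine Finset.sum_congr rfl fun i _ => ?_
      rw [← smul_add]; congr 1; ext v
      simp [insertMap_apply, insArgs, MultilinearMap.map_update_add])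
    (by
      intro c f g
      rw [Finset.smul_sum]
      refine Finset.sum_congr rfl fun i _ => ?_
      rw [smul_comm c]; congr 1; ext v
      simp [insertMap_apply, insArgs, MultilinearMap.map_update_smul])

/-- The Gerstenhaber bracket of `f` of degree `m` and `g` of degree `n`:
`[f, g] = f ⋄ g - (-1)^{m n} g ⋄ f`. -/
def gerstenhaberHom (K V : Type*) [Field K] [AddCommGroup V] [Module K V] (m n : ℕ) :
    Cochain K V V m →ₗ[K] Cochain K V V n →ₗ[K] Cochains K V V :=
  LinearMap.mk₂ K
    (fun f g => DirectSum.lof K ℕ (Cochain K V V) (m + n) (diamond K V m n f g) -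
      (-1 : K) ^ (m * n) • DirectSum.lof K ℕ (Cochain K V V) (n + m) (diamond K V n m g f))
    (by intro f f' g; simp only [map_add, LinearMap.add_apply]; module)
    (by intro c f g; simp only [map_smul, LinearMap.smul_apply]; module)
    (by intro f g g'; simp only [map_add, LinearMap.add_apply]; module)
    (by intro c f g; simp only [map_smul, LinearMap.smul_apply]; module)

/-- The Gerstenhaber bracket on `⨁_{n ≥ 0} Hom(V^{⊗ n+1}, V)`. -/
def gerstenhaber (K V : Type*) [Field K] [AddCommGroup V] [Module K V] :
    Cochains K V V →ₗ[K] Cochains K V V →ₗ[K] Cochains K V V :=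
  DirectSum.toModule K ℕ _ fun m =>
    (DirectSum.toModule K ℕ _ fun n => (gerstenhaberHom K V m n).flip).flip

/-- A bilinear map `V × V → W` as an element of `Hom(V^{⊗ 2}, W)`. -/
def ofBilin (b : V →ₗ[K] V →ₗ[K] W) : Cochain K V W 1 :=
  MultilinearMap.mk' (fun v => b (v 0) (v 1))
    (by intro v i x y; fin_cases i <;> simp [Function.update])
    (by intro v i c x; fin_cases i <;> simp [Function.update])

/-- A linear map `V → W` as an element of `Hom(V^{⊗ 1}, W)`. -/
def ofLin (D : V →ₗ[K] W) : Cochain K V W 0 :=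
  MultilinearMap.mk' (fun v => D (v 0))
    (by intro v i x y; fin_cases i; simp)
    (by intro v i c x; fin_cases i; simp)

variable (K V W) in
/-- The `ℤ`-grading of `⨁_{n ≥ 0} Hom(V^{⊗ n+1}, W)`: degree `n ≥ 0` is `Hom(V^{⊗ n+1}, W)`, and
the negative degrees are zero. -/
def cochainGrading : ℤ → Submodule K (Cochains K V W)
  | Int.ofNat n => LinearMap.range (DirectSum.lof K ℕ (Cochain K V W) n)
  | Int.negSucc _ => ⊥

/-- The Hochschild differential `Hom(V^{⊗ n}, W) → Hom(V^{⊗ n+1}, W)`, for a multiplication `mul`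
on `V`, a left action `lact` and a right action `ract` of `V` on `W`. -/
def hochschild (mul : V →ₗ[K] V →ₗ[K] V) (lact : V →ₗ[K] W →ₗ[K] W) (ract : W →ₗ[K] V →ₗ[K] W)
    {n : ℕ} (f : MultilinearMap K (fun _ : Fin n => V) W) :
    MultilinearMap K (fun _ : Fin (n + 1) => V) W :=
  LinearMap.uncurryLeft (M := fun _ : Fin (n + 1) => V)
      { toFun := fun a => (lact a).compMultilinearMap f
        map_add' := by intro a b; ext v; simp
        map_smul' := by intro c a; ext v; simp }
    + ∑ i : Fin n, (-1 : K) ^ (i.1 + 1) • insertMap rfl f (ofBilin mul) i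
    + (-1 : K) ^ (n + 1) •
      MultilinearMap.uncurryRight (M := fun _ : Fin (n + 1) => V) (ract.compMultilinearMap f)

theorem hochschild_apply (mul : V →ₗ[K] V →ₗ[K] V) (lact : V →ₗ[K] W →ₗ[K] W)
    (ract : W →ₗ[K] V →ₗ[K] W) {n : ℕ} (f : MultilinearMap K (fun _ : Fin n => V) W)
    (a : Fin (n + 1) → V) :
    hochschild mul lact ract f a =
      lact (a 0) (f (fun j => a j.succ))
      + ∑ i : Fin n, (-1 : K) ^ (i.1 + 1) •
          f (fun j => if j < i then a j.castSucc
            else if j = i then mul (a i.castSucc) (a i.succ) else a j.succ)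
      + (-1 : K) ^ (n + 1) • ract (f (fun j => a j.castSucc)) (a (Fin.last n)) := by
  simp only [hochschild, add_apply, sum_apply, smul_apply]
  refine congrArg₂ (· + ·) (congrArg₂ (· + ·) rfl ?_) rfl
  refine Finset.sum_congr rfl fun i _ => ?_
  rw [insertMap_apply]
  congr 2
  funext j
  unfold insArgs
  by_cases hj : j = i
  · subst hj
    rw [Function.update_self]; simp; rfl
  · rw [Function.update_of_ne hj, if_neg hj]; rfl

end Multilinear

/-! ## Quasi-twilled associative algebras and strong deformation maps -/

section QuasiTwilled

/-- The components of a bilinear multiplication on `A ⊕ B` for which `B` is closed. -/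
structure QuasiTwilledData (K A B : Type*) [Field K] [AddCommGroup A] [Module K A]
    [AddCommGroup B] [Module K B] where
  /-- `a ·_A b` -/
  mulA : A →ₗ[K] A →ₗ[K] A
  /-- `x ·_B y` -/
  mulB : B →ₗ[K] B →ₗ[K] B
  /-- `a ▷ x` -/
  lactB : A →ₗ[K] B →ₗ[K] B
  /-- `x ◁ a` -/
  ractB : B →ₗ[K] A →ₗ[K] B
  /-- `x ⇀ a` -/
  lactA : B →ₗ[K] A →ₗ[K] A
  /-- `a ↼ x` -/
  ractA : A →ₗ[K] B →ₗ[K] A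
  /-- `θ(a, b)` -/
  theta : A →ₗ[K] A →ₗ[K] B

/-- The multiplication on `A ⊕ B`:
`(a, x) (b, y) = (a ·_A b + a ↼ y + x ⇀ b, x ·_B y + a ▷ y + x ◁ b + θ(a, b))`. -/
def QuasiTwilledData.mul {K A B : Type*} [Field K] [AddCommGroup A] [Module K A]
    [AddCommGroup B] [Module K B] (T : QuasiTwilledData K A B) (u v : A × B) : A × B :=
  (T.mulA u.1 v.1 + T.ractA u.1 v.2 + T.lactA u.2 v.1,
    T.mulB u.2 v.2 + T.lactB u.1 v.2 + T.ractB u.2 v.1 + T.theta u.1 v.1)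

/-- A quasi-twilled associative algebra structure on `A ⊕ B`, in components: the multiplication is
associative (and `B` is closed under it, by its form). -/
structure QuasiTwilled (K A B : Type*) [Field K] [AddCommGroup A] [Module K A]
    [AddCommGroup B] [Module K B] extends QuasiTwilledData K A B where
  assoc : ∀ u v w : A × B, toQuasiTwilledData.mul (toQuasiTwilledData.mul u v) w =
    toQuasiTwilledData.mul u (toQuasiTwilledData.mul v w)

namespace QuasiTwilled

variable {K A B : Type*} [Field K] [AddCommGroup A] [Module K A] [AddCommGroup B] [Module K B]

/-- A strong deformation map. -/
def IsStrongDeformationMap (Q : QuasiTwilled K A B) (D : A →ₗ[K] B) : Prop :=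
  ∀ a b : A, D (Q.mulA a b + Q.ractA a (D b) + Q.lactA (D a) b) =
    Q.mulB (D a) (D b) + Q.lactB a (D b) + Q.ractB (D a) b + Q.theta a b

/-- `θ~((a, x), (b, y)) = (0, θ(a, b))`, of bidegree `2|-1`. -/
def thetaTilde (Q : QuasiTwilled K A B) : (A × B) →ₗ[K] (A × B) →ₗ[K] (A × B) :=
  (Q.theta.compl₁₂ (LinearMap.fst K A B) (LinearMap.fst K A B)).compr₂ (LinearMap.inr K A B)

/-- `μ_{▷,◁}((a, x), (b, y)) = (a ·_A b, a ▷ y + x ◁ b)`, of bidegree `1|0`. -/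
def muAct (Q : QuasiTwilled K A B) : (A × B) →ₗ[K] (A × B) →ₗ[K] (A × B) :=
  (Q.mulA.compl₁₂ (LinearMap.fst K A B) (LinearMap.fst K A B)).compr₂ (LinearMap.inl K A B)
  + (Q.lactB.compl₁₂ (LinearMap.fst K A B) (LinearMap.snd K A B)).compr₂ (LinearMap.inr K A B)
  + (Q.ractB.compl₁₂ (LinearMap.snd K A B) (LinearMap.fst K A B)).compr₂ (LinearMap.inr K A B)

/-- `ν_{⇀,↼}((a, x), (b, y)) = (a ↼ y + x ⇀ b, x ·_B y)`, of bidegree `0|1`. -/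
def nuAct (Q : QuasiTwilled K A B) : (A × B) →ₗ[K] (A × B) →ₗ[K] (A × B) :=
  (Q.ractA.compl₁₂ (LinearMap.fst K A B) (LinearMap.snd K A B)).compr₂ (LinearMap.inl K A B)
  + (Q.lactA.compl₁₂ (LinearMap.snd K A B) (LinearMap.fst K A B)).compr₂ (LinearMap.inl K A B)
  + (Q.mulB.compl₁₂ (LinearMap.snd K A B) (LinearMap.snd K A B)).compr₂ (LinearMap.inr K A B)

theorem thetaTilde_apply (Q : QuasiTwilled K A B) (a b : A) (x y : B) :
    Q.thetaTilde (a, x) (b, y) = (0, Q.theta a b) := rfl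

theorem muAct_apply (Q : QuasiTwilled K A B) (a b : A) (x y : B) :
    Q.muAct (a, x) (b, y) = (Q.mulA a b, Q.lactB a y + Q.ractB x b) := by
  simp [muAct]

theorem nuAct_apply (Q : QuasiTwilled K A B) (a b : A) (x y : B) :
    Q.nuAct (a, x) (b, y) = (Q.ractA a y + Q.lactA x b, Q.mulB x y) := by
  simp [nuAct]

/-- The structure element `Ω = θ~ + μ_{▷,◁} + ν_{⇀,↼}`, of degree one. -/
def omegaElt (Q : QuasiTwilled K A B) : Cochains K (A × B) (A × B) :=
  DirectSum.lof K ℕ (Cochain K (A × B) (A × B)) 1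
    (ofBilin (Q.thetaTilde + Q.muAct + Q.nuAct))

variable (K A B) in
/-- The inclusion of `𝔞 = ⨁ Hom(A^{⊗ n+1}, B)` in `𝔤 = ⨁ Hom((A ⊕ B)^{⊗ n+1}, A ⊕ B)`: `f` is sent
to `((a_0, x_0), ..., (a_n, x_n)) ↦ (0, f(a_0, ..., a_n))`. -/
def incl : Cochains K A B →ₗ[K] Cochains K (A × B) (A × B) :=
  DirectSum.lmap fun _ =>
    { toFun := fun f => (LinearMap.inr K A B).compMultilinearMap
        (f.compLinearMap fun _ => LinearMap.fst K A B)
      map_add' := by intro f g; ext v <;> simp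
      map_smul' := by intro c f; ext v <;> simp }

variable (K A B) in
/-- The projection `P : 𝔤 → 𝔞`: restrict to the arguments in `A` and take the `B`-component. Its
kernel is the sum of the other bidegrees. -/
def proj : Cochains K (A × B) (A × B) →ₗ[K] Cochains K A B :=
  DirectSum.lmap fun _ =>
    { toFun := fun F => (LinearMap.snd K A B).compMultilinearMap
        (F.compLinearMap fun _ => LinearMap.inl K A B)
      map_add' := by intro f g; ext v; simp
      map_smul' := by intro c f; ext v; simp }

/-- The iterated bracket `[⋯[[Ω, f_1], f_2], ⋯, f_k]` in `𝔤`. -/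
def iterBracket (Q : QuasiTwilled K A B) :
    (k : ℕ) → (Fin k → Cochains K A B) → Cochains K (A × B) (A × B)
  | 0, _ => Q.omegaElt
  | k + 1, x => gerstenhaber K (A × B) (iterBracket Q k fun i => x i.castSucc)
      (incl K A B (x (Fin.last k)))

/-- The operations of the controlling algebra on `𝔞`, as higher derived brackets
`l_k(f_1, ..., f_k) = P[⋯[[Ω, f_1], f_2], ⋯, f_k]`. -/
def controllingOp (Q : QuasiTwilled K A B) (k : ℕ) (x : Fin k → Cochains K A B) :
    Cochains K A B :=
  proj K A B (Q.iterBracket k x)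

/-- `D : A → B` as an element of `𝔞_0`. -/
def degZero (D : A →ₗ[K] B) : Cochains K A B :=
  DirectSum.lof K ℕ (Cochain K A B) 0 (ofLin D)

/-- The operations `l_k^D`, obtained by twisting the controlling algebra by `D`. -/
def governingOp (Q : QuasiTwilled K A B) (D : A →ₗ[K] B) (k : ℕ)
    (x : Fin k → Cochains K A B) : Cochains K A B :=
  twist K Q.controllingOp (degZero D) k x

/-- `a ·_D b = a ·_A b + a ↼ D(b) + D(a) ⇀ b`. -/
def mulD (Q : QuasiTwilled K A B) (D : A →ₗ[K] B) : A →ₗ[K] A →ₗ[K] A :=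
  Q.mulA + Q.ractA.compl₂ D + Q.lactA.comp D

/-- `a ▷_D x = a ▷ x + D(a) ·_B x - D(a ↼ x)`. -/
def lactD (Q : QuasiTwilled K A B) (D : A →ₗ[K] B) : A →ₗ[K] B →ₗ[K] B :=
  Q.lactB + Q.mulB.comp D - Q.ractA.compr₂ D

/-- `x ◁_D a = x ◁ a + x ·_B D(a) - D(x ⇀ a)`. -/
def ractD (Q : QuasiTwilled K A B) (D : A →ₗ[K] B) : B →ₗ[K] A →ₗ[K] B :=
  Q.ractB + Q.mulB.compl₂ D - Q.lactA.compr₂ D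

/-- The differential `δ^D : Hom(A^{⊗ n}, B) → Hom(A^{⊗ n+1}, B)` of the strong deformation map `D`:
the Hochschild differential of `A_D` with coefficients in `(B, ▷_D, ◁_D)`. -/
def deltaD (Q : QuasiTwilled K A B) (D : A →ₗ[K] B) {n : ℕ}
    (f : MultilinearMap K (fun _ : Fin n => A) B) :
    MultilinearMap K (fun _ : Fin (n + 1) => A) B :=
  hochschild (Q.mulD D) (Q.lactD D) (Q.ractD D) f

end QuasiTwilled

end QuasiTwilled

end

/-! The proof rests on two devices: a weight on `𝔤` and a change of coordinates on `A ⊕ B`.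

Conjugation by `(a, x) ↦ (a, 2x)` respects the Gerstenhaber bracket and multiplies by `2 ^ q` on the
cochains with `q` more arguments in `B` than values in `B`. Thus `θ~`, `μ`, `ν` and the elements of
`𝔞` are eigenvectors for `1/2`, `1`, `2` and `1/2`. A cochain has only one value, so `q ≥ -1`:
weight `1/4` is zero, weight `1/2` is exactly `𝔞`, and `P` kills weight `1`. Hence `𝔞` is abelian,
`[θ~, 𝔞] = 0`, `[μ, 𝔞]` and `[[ν, 𝔞], 𝔞]` lie in `𝔞`, and `P[ν, f] = 0`. The formulas for `l_k`
follow.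

In the coordinates `(a, x) ↦ (a, x + D a)` the multiplication is again quasi-twilled, and the
equation for `D` says that its `θ`-component vanishes (`deform`). Its `μ` is `μ + [ν, D]` and its
`ν` is the old one, so the twisted operations are the controlling operations of the new structure
(`governingOp_eq`). The `L_∞` identities are therefore needed only for `θ = 0`. There the weights
split `[Ω, Ω] = 0`, which is associativity, into `[μ, μ] = [μ, ν] = [ν, ν] = 0`
(`bracket_relations`), and the derived bracket argument applies (`IsGradedLie.isLInfty`). It uses
that the Gerstenhaber bracket is graded Lie, which comes from the pre-Lie identity for `⋄`
(`isGradedPreLie_circ`).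

Strong deformation maps are the zeros of `l_0 + l_1(D) + ½ l_2(D, D)`
(`isStrongDeformationMap_iff`); expanding this quadratic expression at `D + D'` gives the third
claim. The last claim is the expansion of `[μ, f]` into Hochschild terms (`opOne_lof`), applied to
the deformed structure. -/

noncomputable section

/-! ### Insertions evaluated on sequences, and the associator of `⋄`. -/

section SeqEval

variable {K : Type*} [Field K] {V W : Type*} [AddCommGroup V] [Module K V]
  [AddCommGroup W] [Module K W]

/-- Evaluation of a map of `m` arguments on the first `m` terms of a sequence. -/
def seqEval {m : ℕ} (f : MultilinearMap K (fun _ : Fin m => V) W) (v : ℕ → V) : W :=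
  f fun k => v k.1

/-- The sequence `v` with `y` in place of the block of `n + 1` entries that starts at place `i`. -/
def insSeq {V : Type*} (i n : ℕ) (y : V) (v : ℕ → V) : ℕ → V := fun j =>
  if j < i then v j else if j = i then y else v (j + n)

theorem seqEval_insertMap {m n p : ℕ} (h : p = m + n) (f : MultilinearMap K (fun _ : Fin m => V) W)
    (g : MultilinearMap K (fun _ : Fin (n + 1) => V) V) (i : Fin m) (v : ℕ → V) :
    seqEval (insertMap h f g i) v =
      seqEval f (insSeq i n (seqEval g fun k => v (i + k)) v) := by
  unfold seqEval
  rw [insertMap_apply]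
  congr 1
  funext j
  unfold insArgs insSeq
  by_cases hj : j = i
  · subst hj
    simp only [Function.update_self, lt_irrefl, if_true, if_false]
    rfl
  · have hj' : j.1 ≠ i.1 := fun e => hj (Fin.ext e)
    rw [Function.update_of_ne hj]
    simp [hj']

theorem seqEval_insSeq {m : ℕ} (f : MultilinearMap K (fun _ : Fin m => V) W) {i : ℕ} (hi : i < m)
    (n : ℕ) (y : V) (v : ℕ → V) :
    seqEval f (insSeq i n y v) =
      f (Function.update (fun j : Fin m => insSeq i n 0 v j) ⟨i, hi⟩ y) := by
  unfold seqEval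
  congr 1
  funext j
  by_cases hj : j = ⟨i, hi⟩
  · subst hj; simp [insSeq]
  · have hj' : j.1 ≠ i := fun e => hj (Fin.ext e)
    rw [Function.update_of_ne hj]
    simp [insSeq, hj']

theorem seqEval_insSeq_sum {m : ℕ} (f : MultilinearMap K (fun _ : Fin m => V) W) {i : ℕ}
    (hi : i < m) (n : ℕ) {ι : Type*} (s : Finset ι) (c : ι → K) (y : ι → V) (v : ℕ → V) :
    seqEval f (insSeq i n (∑ a ∈ s, c a • y a) v) =
      ∑ a ∈ s, c a • seqEval f (insSeq i n (y a) v) := by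
  simp only [seqEval_insSeq f hi]
  simp [MultilinearMap.map_update_sum, MultilinearMap.map_update_smul]

theorem seqEval_diamond {m n : ℕ} (f : Cochain K V V m) (g : Cochain K V V n) (v : ℕ → V) :
    seqEval (diamond K V m n f g) v = ∑ i ∈ Finset.range (m + 1), (-1 : K) ^ (i * n) •
      seqEval f (insSeq i n (seqEval g fun k => v (i + k)) v) := by
  rw [Finset.sum_range]
  simp only [← seqEval_insertMap (K := K) (p := m + n + 1) (by omega) f g]
  simp [diamond, seqEval]

/-- Degrees such as `m + n + p` and `m + (n + p)` agree only propositionally. Sequences are a common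
domain for both sides, so no casts between arities are needed. -/
theorem lof_eq_of_seqEval {m n : ℕ} (h : m = n) (f : Cochain K V W m) (g : Cochain K V W n)
    (hfg : ∀ v, seqEval f v = seqEval g v) :
    DirectSum.lof K ℕ (Cochain K V W) m f = DirectSum.lof K ℕ (Cochain K V W) n g := by
  subst h
  congr 1
  ext v
  -- A tuple is padded with zeros to a sequence; the padding is never read.
  have := hfg fun j => if h : j < m + 1 then v ⟨j, h⟩ else 0
  simpa only [seqEval, Fin.is_lt, dite_true, Fin.eta] using this

theorem exists_lof_eq {m n : ℕ} (h : m = n) (f : Cochain K V W m) :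
    ∃ g : Cochain K V W n, DirectSum.lof K ℕ (Cochain K V W) m f =
      DirectSum.lof K ℕ (Cochain K V W) n g ∧ ∀ v, seqEval g v = seqEval f v := by
  subst h
  exact ⟨f, rfl, fun _ => rfl⟩

/-- The sequence `v` with `G` applied to the block of `n + 1` entries in place `a` and `H` applied
to the block of `p + 1` entries in place `b`. -/
def insPair (a n : ℕ) (G : (ℕ → V) → V) (b p : ℕ) (H : (ℕ → V) → V) (v : ℕ → V) : ℕ → V := fun j =>
  if j < a then v j else if j = a then G fun k => v (a + k) else if j < b then v (j + n)
  else if j = b then H fun k => v (b + n + k) else v (j + n + p)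

/-- The signed sum over the insertions of `G` and `H` into disjoint places, `G` before `H`. -/
def pairSum {m : ℕ} (f : Cochain K V W m) (n : ℕ) (G : (ℕ → V) → V) (p : ℕ) (H : (ℕ → V) → V)
    (v : ℕ → V) : W :=
  ∑ b ∈ Finset.range (m + 1), ∑ a ∈ Finset.range b,
    (-1 : K) ^ (a * n + b * p) • seqEval f (insPair a n G b p H v)

/-- The block at `l` lies before place `i`, so the two insertions are disjoint and the block of `g`
starts at place `i + p` of the original sequence. -/
theorem insSeq_insSeq_lt {i l : ℕ} (h : l < i) (n p : ℕ) {m : ℕ} (g : Cochain K V V m)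
    (y : V) (v : ℕ → V) (H : (ℕ → V) → V) (hy : y = H fun k => v (l + k)) :
    insSeq i n (seqEval g fun k => insSeq l p y v (i + k)) (insSeq l p y v) =
      insPair l p H i n (seqEval g) v := by
  subst hy
  funext j
  unfold insSeq insPair
  have e : (fun k => if i + k < l then v (i + k) else
      if i + k = l then H fun k => v (l + k) else v (i + k + p)) = fun k => v (i + p + k) := by
    funext k
    rw [if_neg (by omega), if_neg (by omega)]
    congr 1; omega
  rw [e]
  by_cases h1 : j < i
  · simp only [h1, if_true]
  · by_cases h2 : j = i
    · subst h2; simp [show ¬ j < l by omega, show ¬ j = l by omega]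
    · simp only [h1, h2, if_false]
      simp only [show ¬ j + n < l by omega, show ¬ j + n = l by omega, show ¬ j < l by omega,
        show ¬ j = l by omega, if_false]
      congr 1; omega

theorem insSeq_insSeq_gt {i k : ℕ} (h : i < k) (n p : ℕ) (g : Cochain K V V n)
    (y : V) (v : ℕ → V) (H : (ℕ → V) → V) (hy : y = H fun j => v (k + n + j)) :
    insSeq i n (seqEval g fun j => insSeq (k + n) p y v (i + j)) (insSeq (k + n) p y v) =
      insPair i n (seqEval g) k p H v := by
  subst hy
  have e : (seqEval g fun j => insSeq (k + n) p (H fun j => v (k + n + j)) v (i + j)) =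
      seqEval g fun j => v (i + j) := by
    unfold seqEval
    congr 1
    funext j
    exact if_pos (by omega)
  rw [e]
  funext j
  unfold insSeq insPair
  by_cases h1 : j < i
  · simp only [h1, if_true, show j < k + n by omega]
  · by_cases h2 : j = i
    · subst h2; simp
    · simp only [h1, h2, if_false, add_lt_add_iff_right, add_left_inj]

/-- Here the inner block falls inside the block of `g`: the nested case, which reproduces `f ⋄ (g ⋄
h)`. -/
theorem insSeq_insSeq_mid {i l : ℕ} {n : ℕ} (h : l < n + 1) (p : ℕ) (g : Cochain K V V n)
    (y : V) (v : ℕ → V) :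
    insSeq i n (seqEval g fun j => insSeq (i + l) p y v (i + j)) (insSeq (i + l) p y v) =
      insSeq i (n + p) (seqEval g (insSeq l p y fun j => v (i + j))) v := by
  have e : (fun j => insSeq (i + l) p y v (i + j)) = insSeq l p y fun j => v (i + j) := by
    funext j
    unfold insSeq
    simp only [add_lt_add_iff_left, add_right_inj, add_assoc]
  rw [e]
  funext j
  unfold insSeq
  by_cases h1 : j < i
  · simp [h1, show j < i + l by omega]
  · by_cases h2 : j = i
    · subst h2; simp
    · simp only [h1, h2, if_false, show ¬ j + n < i + l by omega, show ¬ j + n = i + l by omega,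
        add_assoc]

/-- In `(f ⋄ g) ⋄ h` the map `h` is inserted before, inside or after `g`. The nested terms give `f ⋄
(g ⋄ h)`. The disjoint ones are left as the associator, whose two sums are exchanged, up to the sign
`(-1)^(n p)`, when `g` and `h` are. -/
theorem seqEval_diamond_diamond {m n p : ℕ} (f : Cochain K V V m) (g : Cochain K V V n)
    (h : Cochain K V V p) (v : ℕ → V) :
    seqEval (diamond K V (m + n) p (diamond K V m n f g) h) v =
      seqEval (diamond K V m (n + p) f (diamond K V n p g h)) v +
      (pairSum f p (seqEval h) n (seqEval g) v +
        (-1 : K) ^ (n * p) • pairSum f n (seqEval g) p (seqEval h) v) := by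
  -- The places for `h` are cut into those before the block of `g` at `i`, the `n + 1` places in it,
  -- and those after it, indexed by the place `k > i` of `f` to which they belong.
  have split : ∀ (i : ℕ), i < m + 1 → ∀ X : ℕ → V, ∑ l ∈ Finset.range (m + n + 1), X l =
      ∑ l ∈ Finset.range i, X l + (∑ l ∈ Finset.range (n + 1), X (i + l) +
        ∑ k ∈ Finset.Ico (i + 1) (m + 1), X (k + n)) := by
    intro i hi X
    rw [← Finset.sum_range_add_sum_Ico X (show i ≤ m + n + 1 by omega),
      ← Finset.sum_Ico_consecutive X (show i ≤ i + (n + 1) by omega)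
        (show i + (n + 1) ≤ m + n + 1 by omega), Finset.sum_Ico_eq_sum_range X i (i + (n + 1)),
      Finset.sum_Ico_add' X (i + 1) (m + 1) n, show i + (n + 1) - i = n + 1 by omega,
      show i + 1 + n = i + (n + 1) by omega, show m + 1 + n = m + n + 1 by omega]
  rw [seqEval_diamond]
  simp only [seqEval_diamond f g, Finset.smul_sum, smul_smul]
  rw [Finset.sum_comm]
  rw [Finset.sum_congr rfl fun i hi => split i (Finset.mem_range.1 hi) _]
  rw [Finset.sum_add_distrib, Finset.sum_add_distrib]
  have mid : ∑ i ∈ Finset.range (m + 1), ∑ l ∈ Finset.range (n + 1),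
      ((-1 : K) ^ ((i + l) * p) * (-1) ^ (i * n)) •
        seqEval f (insSeq i n (seqEval g fun k =>
          insSeq (i + l) p (seqEval h fun k => v (i + l + k)) v (i + k))
            (insSeq (i + l) p (seqEval h fun k => v (i + l + k)) v)) =
      seqEval (diamond K V m (n + p) f (diamond K V n p g h)) v := by
    rw [seqEval_diamond]
    refine Finset.sum_congr rfl fun i hi => ?_
    simp only [seqEval_diamond g h]
    rw [seqEval_insSeq_sum f (Finset.mem_range.1 hi), Finset.smul_sum]
    refine Finset.sum_congr rfl fun l hl => ?_
    rw [insSeq_insSeq_mid (Finset.mem_range.1 hl), smul_smul]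
    congr 1
    · ring
    · simp only [add_assoc]
  have low : ∑ i ∈ Finset.range (m + 1), ∑ l ∈ Finset.range i,
      ((-1 : K) ^ (l * p) * (-1) ^ (i * n)) •
        seqEval f (insSeq i n (seqEval g fun k =>
          insSeq l p (seqEval h fun k => v (l + k)) v (i + k))
            (insSeq l p (seqEval h fun k => v (l + k)) v)) =
      pairSum f p (seqEval h) n (seqEval g) v := by
    refine Finset.sum_congr rfl fun i hi => Finset.sum_congr rfl fun l hl => ?_
    rw [insSeq_insSeq_lt (Finset.mem_range.1 hl) n p g _ v (seqEval h) rfl, pow_add]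
  have high : ∑ i ∈ Finset.range (m + 1), ∑ k ∈ Finset.Ico (i + 1) (m + 1),
      ((-1 : K) ^ ((k + n) * p) * (-1) ^ (i * n)) •
        seqEval f (insSeq i n (seqEval g fun j =>
          insSeq (k + n) p (seqEval h fun j => v (k + n + j)) v (i + j))
            (insSeq (k + n) p (seqEval h fun j => v (k + n + j)) v)) =
      (-1 : K) ^ (n * p) • pairSum f n (seqEval g) p (seqEval h) v := by
    unfold pairSum
    rw [Finset.sum_comm' (s' := fun k => Finset.range k) (t' := Finset.range (m + 1))
      (by intro x y; simp only [Finset.mem_range, Finset.mem_Ico]; omega)]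
    rw [Finset.smul_sum]
    refine Finset.sum_congr rfl fun k hk => ?_
    rw [Finset.smul_sum]
    refine Finset.sum_congr rfl fun i hi => ?_
    rw [insSeq_insSeq_gt (Finset.mem_range.1 hi) n p g _ v (seqEval h) rfl, smul_smul]
    congr 1
    ring
  rw [mid, low, high]
  abel

end SeqEval

/-! ### Graded Lie brackets from pre-Lie products, and derived bracket identities. -/

section GradedLie

variable {K : Type*} [Field K] {L : Type*} [AddCommGroup L] [Module K L]

theorem negOnePow_smul_eq (k : ℕ) (x : L) : Int.negOnePow (k : ℤ) • x = (-1 : K) ^ k • x := by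
  rcases Nat.even_or_odd k with h | h
  · rw [Int.negOnePow_even _ (by exact_mod_cast h), h.neg_one_pow, one_smul, one_smul]
  · rw [Int.negOnePow_odd _ (by exact_mod_cast h), h.neg_one_pow, Units.neg_smul, one_smul,
      neg_one_smul]

/-- A product on a graded vector space whose associator is graded symmetric in the last two
arguments. -/
structure IsGradedPreLie (𝒢 : ℤ → Submodule K L) (c : L →ₗ[K] L →ₗ[K] L) : Prop where
  mem : ∀ {p q x y}, x ∈ 𝒢 p → y ∈ 𝒢 q → c x y ∈ 𝒢 (p + q)
  associator : ∀ {p q r x y z}, x ∈ 𝒢 p → y ∈ 𝒢 q → z ∈ 𝒢 r →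
    c (c x y) z - c x (c y z) = Int.negOnePow (q * r) • (c (c x z) y - c x (c z y))

/-- A graded Lie bracket on a graded vector space. -/
structure IsGradedLie (𝒢 : ℤ → Submodule K L) (br : L →ₗ[K] L →ₗ[K] L) : Prop where
  mem : ∀ {p q x y}, x ∈ 𝒢 p → y ∈ 𝒢 q → br x y ∈ 𝒢 (p + q)
  antisymm : ∀ {p q x y}, x ∈ 𝒢 p → y ∈ 𝒢 q → br x y = -(Int.negOnePow (p * q) • br y x)
  jacobi : ∀ {p q r x y z}, x ∈ 𝒢 p → y ∈ 𝒢 q → z ∈ 𝒢 r →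
    br x (br y z) = br (br x y) z + Int.negOnePow (p * q) • br y (br x z)

/-- The graded commutator of a graded pre-Lie product is a graded Lie bracket. -/
theorem IsGradedPreLie.isGradedLie {𝒢 : ℤ → Submodule K L} {c br : L →ₗ[K] L →ₗ[K] L}
    (hc : IsGradedPreLie 𝒢 c) (hbr : ∀ {p q x y}, x ∈ 𝒢 p → y ∈ 𝒢 q →
      br x y = c x y - Int.negOnePow (p * q) • c y x) : IsGradedLie 𝒢 br := by
  have hmem : ∀ {p q x y}, x ∈ 𝒢 p → y ∈ 𝒢 q → br x y ∈ 𝒢 (p + q) := by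
    intro p q x y hx hy
    rw [hbr hx hy, Units.smul_def]
    refine sub_mem (hc.mem hx hy) (zsmul_mem ?_ _)
    rw [add_comm]
    exact hc.mem hy hx
  refine ⟨hmem, ?_, ?_⟩
  · intro p q x y hx hy
    rw [hbr hx hy, hbr hy hx, mul_comm q p]
    rcases Int.even_or_odd (p * q) with h | h
    · simp [Int.negOnePow_even _ h]
    · simp [Int.negOnePow_odd _ h, add_comm]
  · intro a b d x y z hx hy hz
    -- The twelve terms of the Jacobi identity are the pre-Lie identities for the three cyclic
    -- orders, weighted by signs. Only the parities of the pairwise degree products matter, so the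
    -- signs are then treated as arbitrary units.
    have h1 := hc.associator hx hy hz
    have h2 := hc.associator hy hz hx
    have h3 := hc.associator hz hx hy
    rw [hbr hx (hmem hy hz), hbr (hmem hx hy) hz, hbr hy (hmem hx hz), hbr hx hy, hbr hy hz,
      hbr hx hz]
    simp only [mul_add, add_mul, Int.negOnePow_add, mul_comm b a, mul_comm d a] at *
    generalize Int.negOnePow (a * b) = s at *
    generalize Int.negOnePow (b * d) = t at *
    generalize Int.negOnePow (a * d) = u at *
    have h2' := congrArg ((s * u) • ·) h2
    have h3' := congrArg ((u * t) • ·) h3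
    clear h2 h3
    rcases Int.units_eq_one_or s with rfl | rfl <;> rcases Int.units_eq_one_or t with rfl | rfl <;>
      rcases Int.units_eq_one_or u with rfl | rfl <;>
      simp only [mul_one, mul_neg, neg_neg, Units.neg_smul, one_smul, map_sub, map_neg,
        LinearMap.sub_apply, LinearMap.neg_apply] at * <;>
      linear_combination (norm := abel) -h1 - h2' - h3'

namespace IsGradedLie

variable {𝒢 : ℤ → Submodule K L} {br : L →ₗ[K] L →ₗ[K] L}

theorem bracket_comm_of_bracket_eq_zero (H : IsGradedLie 𝒢 br) {p : ℤ} {x y z : L}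
    (hx : x ∈ 𝒢 1) (hy : y ∈ 𝒢 1)
    (hz : z ∈ 𝒢 p) (hxy : br x y = 0) : br x (br y z) = -br y (br x z) := by
  rw [H.jacobi hx hy hz, hxy, map_zero, LinearMap.zero_apply, zero_add, mul_one,
    Int.negOnePow_one, Units.neg_smul, one_smul]

theorem bracket_bracket_self [CharZero K] (H : IsGradedLie 𝒢 br) {p : ℤ} {x z : L}
    (hx : x ∈ 𝒢 1) (hz : z ∈ 𝒢 p)
    (hxx : br x x = 0) : br x (br x z) = 0 := by
  have h := H.bracket_comm_of_bracket_eq_zero hx hx hz hxx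
  have h2 : (2 : K) • br x (br x z) = 0 := by linear_combination (norm := module) h
  exact (smul_eq_zero.1 h2).resolve_left two_ne_zero

/-- Apply `[n, ·]` to `[x, y] = 0`: the two terms of the Jacobi identity must cancel. -/
theorem derived_symm (H : IsGradedLie 𝒢 br) {a b : ℤ} {n x y : L} (hn : n ∈ 𝒢 1)
    (hx : x ∈ 𝒢 a) (hy : y ∈ 𝒢 b) (hxy : br x y = 0) :
    br (br n x) y = Int.negOnePow (a * b) • br (br n y) x := by
  have hj := H.jacobi hn hx hy
  rw [hxy, map_zero, H.antisymm hx (H.mem hn hy), smul_neg,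
    smul_smul, ← Int.negOnePow_add, show 1 * a + a * (1 + b) = a * b + (a + a) by ring,
    Int.negOnePow_add, Int.negOnePow_even _ (Even.add_self a), mul_one] at hj
  exact add_neg_eq_zero.1 hj.symm

/-- `[m, ·]` is an odd derivation and anticommutes with `[n, ·]` because `[m, n] = 0`;
`derived_symm` turns `[[n, x], [m, y]]` into the last term. -/
theorem derived_leibniz (H : IsGradedLie 𝒢 br) {a b : ℤ} {m n x y : L} (hm : m ∈ 𝒢 1) (hn : n ∈ 𝒢 1)
    (hmn : br m n = 0) (hx : x ∈ 𝒢 a) (hy : y ∈ 𝒢 b) (hxy : br (br m y) x = 0) :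
    br m (br (br n x) y) + br (br n (br m x)) y +
      Int.negOnePow (a * b) • br (br n (br m y)) x = 0 := by
  rw [H.derived_symm hn (H.mem hm hy) hx hxy, smul_smul, ← Int.negOnePow_add,
    show a * b + (1 + b) * a = a + (a * b + a * b) by ring, Int.negOnePow_add,
    Int.negOnePow_even _ (Even.add_self (a * b)), mul_one, H.jacobi hm (H.mem hn hx) hy,
    H.bracket_comm_of_bracket_eq_zero hm hn hx hmn, map_neg, LinearMap.neg_apply, one_mul,
    add_comm 1 a, Int.negOnePow_succ, Units.neg_smul]
  abel

/-- This is the Jacobi identity for `[n, x]`, `[n, y]`, `z`. Since `[n, [n, x]] = 0`, the inner part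
`[n, [[n, x], y]]` is `[[n, x], [n, y]]` up to sign, and `derived_symm` rewrites the other two
terms. -/
theorem derived_jacobi [CharZero K] (H : IsGradedLie 𝒢 br) {a b c : ℤ} {n x y z : L}
    (hn : n ∈ 𝒢 1) (hnn : br n n = 0) (hx : x ∈ 𝒢 a) (hy : y ∈ 𝒢 b) (hz : z ∈ 𝒢 c)
    (hxz : br (br (br n x) z) y = 0)
    (hyz : br (br (br n y) z) x = 0) :
    br (br n (br (br n x) y)) z + Int.negOnePow (b * c) • br (br n (br (br n x) z)) y +
      Int.negOnePow (a * b + a * c) • br (br n (br (br n y) z)) x = 0 := by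
  rw [H.derived_symm hn (H.mem (H.mem hn hx) hz) hy hxz,
    H.derived_symm hn (H.mem (H.mem hn hy) hz) hx hyz, H.jacobi hn (H.mem hn hx) hy,
    H.bracket_bracket_self hn hx hnn, map_zero, LinearMap.zero_apply, zero_add, Units.smul_def,
    map_zsmul, LinearMap.smul_apply, ← Units.smul_def, H.jacobi (H.mem hn hx) (H.mem hn hy) hz]
  generalize br (br n x) (br (br n y) z) = X
  generalize br (br n y) (br (br n x) z) = Y
  simp only [mul_add, add_mul, one_mul, mul_one, Int.negOnePow_add, Int.negOnePow_one,
    mul_comm c, mul_comm b a, smul_add, smul_smul]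
  generalize Int.negOnePow a = s
  generalize Int.negOnePow b = t
  generalize Int.negOnePow (a * b) = r
  generalize Int.negOnePow (b * c) = q
  generalize Int.negOnePow (a * c) = p
  rcases Int.units_eq_one_or s with rfl | rfl <;> rcases Int.units_eq_one_or t with rfl | rfl <;>
    rcases Int.units_eq_one_or r with rfl | rfl <;>
    rcases Int.units_eq_one_or q with rfl | rfl <;>
    rcases Int.units_eq_one_or p with rfl | rfl <;>
    simp only [mul_one, mul_neg, neg_neg, Units.neg_smul, one_smul] <;> abel

end IsGradedLie

end GradedLie

/-! ### The Gerstenhaber bracket is a graded Lie bracket. -/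

section Bracket

variable {K : Type*} [Field K] {V W : Type*} [AddCommGroup V] [Module K V]
  [AddCommGroup W] [Module K W]

variable (K V) in
/-- The product `⋄` on `⨁_{n ≥ 0} Hom(V^{⊗ n+1}, V)`. -/
def circ : Cochains K V V →ₗ[K] Cochains K V V →ₗ[K] Cochains K V V :=
  DirectSum.toModule K ℕ _ fun m =>
    (DirectSum.toModule K ℕ _ fun n =>
      ((diamond K V m n).compr₂ (DirectSum.lof K ℕ (Cochain K V V) (m + n))).flip).flip

theorem circ_lof {m n : ℕ} (f : Cochain K V V m) (g : Cochain K V V n) :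
    circ K V (DirectSum.lof K ℕ (Cochain K V V) m f) (DirectSum.lof K ℕ (Cochain K V V) n g) =
      DirectSum.lof K ℕ (Cochain K V V) (m + n) (diamond K V m n f g) := by
  simp [circ]

theorem mem_cochainGrading_cases {a : ℤ} {x : Cochains K V W} (hx : x ∈ cochainGrading K V W a) :
    x = 0 ∨ ∃ (n : ℕ) (f : Cochain K V W n),
      a = n ∧ x = DirectSum.lof K ℕ (Cochain K V W) n f := by
  rcases a with n | n
  · obtain ⟨f, rfl⟩ := hx
    exact Or.inr ⟨n, f, rfl, rfl⟩
  · exact Or.inl (by simpa [cochainGrading] using hx)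

theorem lof_mem_cochainGrading {n : ℕ} (f : Cochain K V W n) :
    DirectSum.lof K ℕ (Cochain K V W) n f ∈ cochainGrading K V W (n : ℤ) :=
  ⟨f, rfl⟩

theorem isGradedPreLie_circ : IsGradedPreLie (cochainGrading K V V) (circ K V) where
  mem {p q x y} hx hy := by
    rcases mem_cochainGrading_cases hx with rfl | ⟨m, f, rfl, rfl⟩
    · rw [map_zero, LinearMap.zero_apply]
      exact zero_mem _
    rcases mem_cochainGrading_cases hy with rfl | ⟨n, g, rfl, rfl⟩
    · rw [map_zero]
      exact zero_mem _
    rw [circ_lof, ← Nat.cast_add]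
    exact lof_mem_cochainGrading _
  associator {p q r x y z} hx hy hz := by
    rcases mem_cochainGrading_cases hx with rfl | ⟨m, f, rfl, rfl⟩
    · simp only [map_zero, LinearMap.zero_apply, sub_zero, smul_zero]
    rcases mem_cochainGrading_cases hy with rfl | ⟨n, g, rfl, rfl⟩
    · simp only [map_zero, LinearMap.zero_apply, sub_zero, smul_zero]
    rcases mem_cochainGrading_cases hz with rfl | ⟨p, h, rfl, rfl⟩
    · simp only [map_zero, LinearMap.zero_apply, sub_zero, smul_zero]
    rw [← Nat.cast_mul, negOnePow_smul_eq (K := K)]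
    simp only [circ_lof]
    obtain ⟨r, hr, hr'⟩ := exists_lof_eq (show m + n + p = m + (n + p) by omega)
      (diamond K V (m + n) p (diamond K V m n f g) h)
    obtain ⟨s, hs, hs'⟩ := exists_lof_eq (show m + p + n = m + (n + p) by omega)
      (diamond K V (m + p) n (diamond K V m p f h) g)
    obtain ⟨t, ht, ht'⟩ := exists_lof_eq (show m + (p + n) = m + (n + p) by omega)
      (diamond K V m (p + n) f (diamond K V p n h g))
    rw [hr, hs, ht, ← map_sub, ← map_sub, ← map_smul]
    refine lof_eq_of_seqEval rfl _ _ fun v => ?_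
    -- Both associators are the same two pair sums; the sign `(-1)^(n p)` occurs twice on one of
    -- them and cancels.
    have key : seqEval r v - seqEval (diamond K V m (n + p) f (diamond K V n p g h)) v =
        (-1 : K) ^ (n * p) • (seqEval s v - seqEval t v) := by
      rw [hr', hs', ht', seqEval_diamond_diamond, seqEval_diamond_diamond, add_sub_cancel_left,
        add_sub_cancel_left, smul_add, smul_smul, mul_comm p n, ← pow_add, ← two_mul,
        (even_two_mul (n * p)).neg_one_pow, one_smul, add_comm]
    exact key

theorem gerstenhaber_lof {m n : ℕ} (f : Cochain K V V m) (g : Cochain K V V n) :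
    gerstenhaber K V (DirectSum.lof K ℕ (Cochain K V V) m f)
        (DirectSum.lof K ℕ (Cochain K V V) n g) =
      circ K V (DirectSum.lof K ℕ (Cochain K V V) m f) (DirectSum.lof K ℕ (Cochain K V V) n g) -
      (-1 : K) ^ (m * n) • circ K V (DirectSum.lof K ℕ (Cochain K V V) n g)
        (DirectSum.lof K ℕ (Cochain K V V) m f) := by
  rw [circ_lof, circ_lof]
  simp [gerstenhaber, gerstenhaberHom]

theorem isGradedLie_gerstenhaber :
    IsGradedLie (cochainGrading K V V) (gerstenhaber K V) := by
  refine isGradedPreLie_circ.isGradedLie fun {p q x y} hx hy => ?_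
  rcases mem_cochainGrading_cases hx with rfl | ⟨m, f, rfl, rfl⟩
  · simp only [map_zero, LinearMap.zero_apply, sub_zero, smul_zero]
  rcases mem_cochainGrading_cases hy with rfl | ⟨n, g, rfl, rfl⟩
  · simp only [map_zero, LinearMap.zero_apply, sub_zero, smul_zero]
  rw [← Nat.cast_mul, negOnePow_smul_eq (K := K)]
  exact gerstenhaber_lof f g

end Bracket

/-! ### Conjugation of cochains by linear automorphisms. -/

section Conjugation

variable {K : Type*} [Field K] {V : Type*} [AddCommGroup V] [Module K V]

/-- Conjugation of a multilinear map by a linear automorphism. -/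
def conjHom (e : V ≃ₗ[K] V) (n : ℕ) : Cochain K V V n →ₗ[K] Cochain K V V n where
  toFun f := e.symm.toLinearMap.compMultilinearMap (f.compLinearMap fun _ => e.toLinearMap)
  map_add' f g := by ext v; simp
  map_smul' c f := by ext v; simp

/-- Conjugation by a linear automorphism on `⨁_{n ≥ 0} Hom(V^{⊗ n+1}, V)`. -/
def conjCochains (e : V ≃ₗ[K] V) : Cochains K V V →ₗ[K] Cochains K V V :=
  DirectSum.lmap fun n => conjHom e n

theorem conjHom_apply (e : V ≃ₗ[K] V) {n : ℕ} (f : Cochain K V V n) (v : Fin (n + 1) → V) :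
    conjHom e n f v = e.symm (f fun i => e (v i)) := rfl

theorem conj_lof (e : V ≃ₗ[K] V) {n : ℕ} (f : Cochain K V V n) :
    conjCochains e (DirectSum.lof K ℕ (Cochain K V V) n f) =
      DirectSum.lof K ℕ (Cochain K V V) n (conjHom e n f) := by
  simp [conjCochains, DirectSum.lmap_lof]

theorem conjHom_diamond (e : V ≃ₗ[K] V) {m n : ℕ} (f : Cochain K V V m) (g : Cochain K V V n) :
    conjHom e (m + n) (diamond K V m n f g) = diamond K V m n (conjHom e m f) (conjHom e n g) := by
  ext v
  rw [conjHom_apply]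
  simp only [diamond, LinearMap.mk₂_apply, sum_apply, smul_apply, map_sum, map_smul,
    insertMap_apply, conjHom_apply]
  refine Finset.sum_congr rfl fun i _ => ?_
  congr 3
  funext j
  unfold insArgs insBlock
  by_cases hj : j = i
  · subst hj; simp
  · simp only [Function.update_of_ne hj]
    split_ifs <;> rfl

theorem conj_gerstenhaber (e : V ≃ₗ[K] V) (x y : Cochains K V V) :
    conjCochains e (gerstenhaber K V x y) =
      gerstenhaber K V (conjCochains e x) (conjCochains e y) := by
  induction x using DirectSum.induction_on with
  | zero => simp
  | add x x' hx hx' => simp only [map_add, LinearMap.add_apply, hx, hx']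
  | of m f =>
    induction y using DirectSum.induction_on with
    | zero => simp
    | add y y' hy hy' => simp only [map_add, hy, hy']
    | of n g =>
      change conjCochains e (gerstenhaber K V (DirectSum.lof K ℕ (Cochain K V V) m f)
        (DirectSum.lof K ℕ (Cochain K V V) n g)) = gerstenhaber K V
        (conjCochains e (DirectSum.lof K ℕ (Cochain K V V) m f))
        (conjCochains e (DirectSum.lof K ℕ (Cochain K V V) n g))
      rw [conj_lof, conj_lof, gerstenhaber_lof, gerstenhaber_lof]
      simp only [circ_lof, map_sub, map_smul, conj_lof, conjHom_diamond]

end Conjugation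

/-! ### The weight of a cochain. -/

namespace QuasiTwilled

variable {K A B : Type*} [Field K] [AddCommGroup A] [Module K A] [AddCommGroup B] [Module K B]

/-- `θ~` as an element of `𝔤_1`. -/
def thetaElt (Q : QuasiTwilled K A B) : Cochains K (A × B) (A × B) :=
  DirectSum.lof K ℕ (Cochain K (A × B) (A × B)) 1 (ofBilin Q.thetaTilde)

/-- `μ_{▷,◁}` as an element of `𝔤_1`. -/
def muElt (Q : QuasiTwilled K A B) : Cochains K (A × B) (A × B) :=
  DirectSum.lof K ℕ (Cochain K (A × B) (A × B)) 1 (ofBilin Q.muAct)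

/-- `ν_{⇀,↼}` as an element of `𝔤_1`. -/
def nuElt (Q : QuasiTwilled K A B) : Cochains K (A × B) (A × B) :=
  DirectSum.lof K ℕ (Cochain K (A × B) (A × B)) 1 (ofBilin Q.nuAct)

theorem omegaElt_eq (Q : QuasiTwilled K A B) : Q.omegaElt = Q.thetaElt + Q.muElt + Q.nuElt := by
  unfold omegaElt thetaElt muElt nuElt
  rw [← map_add, ← map_add]
  rfl

theorem incl_lof {n : ℕ} (f : Cochain K A B n) :
    incl K A B (DirectSum.lof K ℕ (Cochain K A B) n f) =
      DirectSum.lof K ℕ (Cochain K (A × B) (A × B)) n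
        ((LinearMap.inr K A B).compMultilinearMap
        (f.compLinearMap fun _ => LinearMap.fst K A B)) := by
  simp [incl, DirectSum.lmap_lof]

theorem proj_lof {n : ℕ} (F : Cochain K (A × B) (A × B) n) :
    proj K A B (DirectSum.lof K ℕ (Cochain K (A × B) (A × B)) n F) =
      DirectSum.lof K ℕ (Cochain K A B) n ((LinearMap.snd K A B).compMultilinearMap
        (F.compLinearMap fun _ => LinearMap.inl K A B)) := by
  simp [proj, DirectSum.lmap_lof]

theorem proj_incl (f : Cochains K A B) : proj K A B (incl K A B f) = f := by
  ext n v
  simp [proj, incl, DirectSum.lmap_apply]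

/-- Splitting each argument into its `A` and `B` parts reduces statements about weights to arguments
of pure type. -/
theorem apply_eq_sum_piecewise {n : ℕ} (F : Cochain K (A × B) (A × B) n) (v : Fin (n + 1) → A × B) :
    F v = ∑ s : Finset (Fin (n + 1)),
      F (s.piecewise (fun i => ((v i).1, 0)) (fun i => (0, (v i).2))) := by
  rw [← MultilinearMap.map_add_univ]
  congr 1
  funext i
  simp

variable (K A B) in
/-- The automorphism `(a, x) ↦ (a, 2 x)` of `A ⊕ B`. -/
def scaleB [CharZero K] : (A × B) ≃ₗ[K] (A × B) :=
  (LinearEquiv.refl K A).prodCongr (LinearEquiv.smulOfNeZero K B (2 : K) two_ne_zero)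

theorem scaleB_apply [CharZero K] (u : A × B) : scaleB K A B u = (u.1, (2 : K) • u.2) := rfl

theorem scaleB_symm_apply [CharZero K] (u : A × B) :
    (scaleB K A B).symm u = (u.1, (2 : K)⁻¹ • u.2) := by
  rw [LinearEquiv.symm_apply_eq, scaleB_apply]
  simp

/-- `x` is an eigenvector of the scaling of `B` by `2`, for the eigenvalue `c`. On the part of
`𝔤` with `q` more arguments in `B` than values in `B` this eigenvalue is `2 ^ q`. -/
def HasWeight [CharZero K] (c : K) (x : Cochains K (A × B) (A × B)) : Prop :=
  conjCochains (scaleB K A B) x = c • x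

variable [CharZero K]

theorem HasWeight.gerstenhaber {c d : K} {x y : Cochains K (A × B) (A × B)} (hx : HasWeight c x)
    (hy : HasWeight d y) : HasWeight (c * d) (gerstenhaber K (A × B) x y) := by
  unfold HasWeight at *
  rw [conj_gerstenhaber, hx, hy, map_smul, map_smul, LinearMap.smul_apply, smul_smul, mul_comm]

theorem hasWeight_lof_ofBilin {c : K} {b : (A × B) →ₗ[K] (A × B) →ₗ[K] (A × B)}
    (h : ∀ u v, (scaleB K A B).symm (b (scaleB K A B u) (scaleB K A B v)) = c • b u v) :
    HasWeight c (DirectSum.lof K ℕ (Cochain K (A × B) (A × B)) 1 (ofBilin b)) := by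
  unfold HasWeight
  rw [conj_lof, ← map_smul]
  congr 1
  ext1 v
  exact h (v 0) (v 1)

theorem thetaElt_hasWeight (Q : QuasiTwilled K A B) : HasWeight (2 : K)⁻¹ Q.thetaElt :=
  hasWeight_lof_ofBilin fun u v => by
    simp [scaleB_apply, scaleB_symm_apply, thetaTilde]

theorem muElt_hasWeight (Q : QuasiTwilled K A B) : HasWeight (1 : K) Q.muElt :=
  hasWeight_lof_ofBilin fun u v => by
    simp [scaleB_apply, scaleB_symm_apply, muAct]

theorem nuElt_hasWeight (Q : QuasiTwilled K A B) : HasWeight (2 : K) Q.nuElt :=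
  hasWeight_lof_ofBilin fun u v => by
    simp [scaleB_apply, scaleB_symm_apply, nuAct]

theorem incl_hasWeight (f : Cochains K A B) : HasWeight (2 : K)⁻¹ (incl K A B f) := by
  refine DFinsupp.ext fun n => ?_
  change conjCochains (scaleB K A B) (incl K A B f) n = (2 : K)⁻¹ • incl K A B f n
  ext v <;> simp [conjCochains, incl, DirectSum.lmap_apply, conjHom_apply,
    scaleB_apply, scaleB_symm_apply]

/-- The values of an eigenvector on arguments that lie in `B` at the places outside `s` and in `A`
at the places in `s`. -/
theorem HasWeight.apply_piecewise {c : K} {x : Cochains K (A × B) (A × B)} (hx : HasWeight c x)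
    (n : ℕ) (s : Finset (Fin (n + 1))) (v : Fin (n + 1) → A × B) :
    let u : Fin (n + 1) → A × B := s.piecewise (fun i => ((v i).1, 0)) (fun i => (0, (v i).2))
    ((2 : K) ^ (sᶜ).card - c) • (x n u).1 = 0 ∧
      ((2 : K) ^ (sᶜ).card - 2 * c) • (x n u).2 = 0 := by
  intro u
  have h : conjHom (scaleB K A B) n (x n) u = c • x n u := by
    have h0 : conjCochains (scaleB K A B) x n = (c • x) n :=
      congrArg (fun z : Cochains K (A × B) (A × B) => z n) hx
    rw [conjCochains, DirectSum.lmap_apply] at h0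
    rw [h0]
    rfl
  -- On arguments of pure type the scaling acts by scalars, which multilinearity collects into `2`
  -- to the number of places in `B`. The inverse scaling of the value gives the extra factor `2` in
  -- the `B`-component.
  have hu : (fun i => scaleB K A B (u i)) =
      fun i => (if i ∈ s then (1 : K) else 2) • u i := by
    funext i
    by_cases hi : i ∈ s <;> simp [u, hi, scaleB_apply]
  rw [conjHom_apply, hu, MultilinearMap.map_smul_univ, Finset.prod_ite, Finset.prod_const_one,
    one_mul, Finset.prod_const, scaleB_symm_apply] at h
  have hs : (Finset.univ.filter fun i => i ∉ s) = sᶜ := by ext; simp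
  rw [hs] at h
  have h1 := congrArg Prod.fst h
  have h2 := congrArg Prod.snd h
  simp only [Prod.smul_fst, Prod.smul_snd, smul_smul] at h1 h2
  refine ⟨by rw [sub_smul, h1, sub_self], ?_⟩
  rw [sub_smul, mul_smul, ← h2, smul_smul, mul_inv_cancel_left₀ two_ne_zero, sub_self]

theorem two_pow_ne_inv (q : ℕ) (k : ℕ) (hk : k ≠ 0) : (2 : K) ^ q - ((2 : K) ^ k)⁻¹ ≠ 0 := by
  intro h
  have h1 : (2 : K) ^ (q + k) = 1 := by
    rw [pow_add, sub_eq_zero.1 h, inv_mul_cancel₀ (pow_ne_zero _ two_ne_zero)]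
  have : (2 : ℕ) ^ (q + k) ≠ 1 := by simp [hk]
  exact this (by exact_mod_cast h1)

/-- The weight `2⁻²` would need at least two more values than arguments in `B`, but there is only
one value. -/
theorem HasWeight.eq_zero {x : Cochains K (A × B) (A × B)} (hx : HasWeight ((2 : K) ^ 2)⁻¹ x) :
    x = 0 := by
  refine DFinsupp.ext fun n => MultilinearMap.ext fun v => ?_
  rw [apply_eq_sum_piecewise]
  refine Finset.sum_eq_zero fun s _ => ?_
  obtain ⟨h1, h2⟩ := hx.apply_piecewise n s v
  have e : (2 : K) * (2 ^ 2)⁻¹ = (2 ^ 1)⁻¹ := by norm_num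
  rw [e] at h2
  exact Prod.ext ((smul_eq_zero.1 h1).resolve_left (two_pow_ne_inv _ _ two_ne_zero))
    ((smul_eq_zero.1 h2).resolve_left (two_pow_ne_inv _ _ one_ne_zero))

/-- The weight `2⁻¹` leaves only one type: all arguments in `A` and the value in `B`. -/
theorem HasWeight.incl_proj {x : Cochains K (A × B) (A × B)} (hx : HasWeight (2 : K)⁻¹ x) :
    incl K A B (proj K A B x) = x := by
  refine DFinsupp.ext fun n => MultilinearMap.ext fun v => ?_
  have h0 : ∀ s : Finset (Fin (n + 1)),
      (x n (s.piecewise (fun i => ((v i).1, 0)) (fun i => (0, (v i).2)))).1 = 0 := fun s =>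
    (smul_eq_zero.1 (hx.apply_piecewise n s v).1).resolve_left
      (by simpa using two_pow_ne_inv (K := K) sᶜ.card 1 one_ne_zero)
  have h1 : ∀ s : Finset (Fin (n + 1)), s ≠ Finset.univ →
      x n (s.piecewise (fun i => ((v i).1, 0)) (fun i => (0, (v i).2))) = 0 := fun s hs => by
    refine Prod.ext (h0 s) ((smul_eq_zero.1 (hx.apply_piecewise n s v).2).resolve_left ?_)
    rw [mul_inv_cancel₀ two_ne_zero, sub_eq_zero]
    have : (2 : ℕ) ^ sᶜ.card ≠ 1 := by
      simpa [Finset.card_eq_zero] using hs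
    exact_mod_cast this
  rw [apply_eq_sum_piecewise (x n), Finset.sum_eq_single Finset.univ (fun s _ hs => h1 s hs)
    (by simp)]
  refine Prod.ext ?_ ?_
  · rw [h0]
    simp [incl, proj, DirectSum.lmap_apply]
  · rw [Finset.piecewise_univ]
    simp [incl, proj, DirectSum.lmap_apply]

/-- With all arguments in `A`, weight `1` forces the value into `A`, which `P` discards. -/
theorem HasWeight.proj_eq_zero {x : Cochains K (A × B) (A × B)} (hx : HasWeight (1 : K) x) :
    proj K A B x = 0 := by
  refine DFinsupp.ext fun n => MultilinearMap.ext fun v => ?_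
  have h := (hx.apply_piecewise n Finset.univ (fun i => (v i, 0))).2
  simp only [Finset.piecewise_univ, Finset.compl_univ, Finset.card_empty, pow_zero] at h
  have := (smul_eq_zero.1 h).resolve_left (by norm_num)
  simpa [proj, DirectSum.lmap_apply] using this

end QuasiTwilled

/-! ### `L_∞`-algebras with only unary and binary operations. -/

section LInfinity

variable {K : Type*} [Field K] {G : Type*} [AddCommGroup G] [Module K G]

theorem koszulSign_one {k : ℕ} (d : Fin k → ℤ) : koszulSign d 1 = 1 := by
  refine Finset.prod_eq_one fun p _ => if_neg fun h => ?_
  exact lt_asymm h.1 h.2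

theorem koszulSign_swap (d : Fin 2 → ℤ) :
    koszulSign d (Equiv.swap 0 1) = Int.negOnePow (d 0 * d 1) := by
  simp [koszulSign, Fintype.prod_prod_type, Fin.prod_univ_two, mul_comm]

theorem koszulSign_swap_one_two (d : Fin 3 → ℤ) :
    koszulSign d (Equiv.swap 1 2) = Int.negOnePow (d 1 * d 2) := by
  have h : (Equiv.swap 1 2 : Equiv.Perm (Fin 3)) 0 = 0 := by decide
  simp [koszulSign, Fintype.prod_prod_type, Fin.prod_univ_three, h, mul_comm]

theorem koszulSign_finRotate (d : Fin 3 → ℤ) :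
    koszulSign d (finRotate 3) = Int.negOnePow (d 0 * d 1 + d 0 * d 2) := by
  simp [koszulSign, Fintype.prod_prod_type, Fin.prod_univ_three, mul_comm,
    Int.negOnePow_add]

/-- A family of operations with only `l_1` and `l_2` nonzero is an `L_∞`-algebra if `l_1` is a
differential, a derivation of the graded symmetric `l_2`, and `l_2` has the Jacobi identity. -/
theorem isLInfty_of_binary {𝒢 : ℤ → Submodule K G} {l : (k : ℕ) → (Fin k → G) → G}
    (hint : DirectSum.IsInternal 𝒢) (l₁ : G →ₗ[K] G) (l₂ : G →ₗ[K] G →ₗ[K] G)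
    (h0 : ∀ x : Fin 0 → G, l 0 x = 0) (h1 : ∀ x : Fin 1 → G, l 1 x = l₁ (x 0))
    (h2 : ∀ x : Fin 2 → G, l 2 x = l₂ (x 0) (x 1))
    (h3 : ∀ k, 3 ≤ k → ∀ x : Fin k → G, l k x = 0)
    (d1 : ∀ {a x}, x ∈ 𝒢 a → l₁ x ∈ 𝒢 (a + 1))
    (d2 : ∀ {a b x y}, x ∈ 𝒢 a → y ∈ 𝒢 b → l₂ x y ∈ 𝒢 (a + b + 1))
    (s2 : ∀ {a b x y}, x ∈ 𝒢 a → y ∈ 𝒢 b → l₂ x y = Int.negOnePow (a * b) • l₂ y x)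
    (j1 : ∀ {a x}, x ∈ 𝒢 a → l₁ (l₁ x) = 0)
    (j2 : ∀ {a b x y}, x ∈ 𝒢 a → y ∈ 𝒢 b →
      l₁ (l₂ x y) + l₂ (l₁ x) y + Int.negOnePow (a * b) • l₂ (l₁ y) x = 0)
    (j3 : ∀ {a b c x y z}, x ∈ 𝒢 a → y ∈ 𝒢 b → z ∈ 𝒢 c →
      l₂ (l₂ x y) z + Int.negOnePow (b * c) • l₂ (l₂ x z) y +
        Int.negOnePow (a * b + a * c) • l₂ (l₂ y z) x = 0) : IsLInfty 𝒢 l where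
  graded := hint
  multilinear k := by
    match k with
    | 0 => exact ⟨0, fun x => (h0 x).symm⟩
    | 1 => exact ⟨ofLin l₁, fun x => (h1 x).symm⟩
    | 2 => exact ⟨ofBilin l₂, fun x => (h2 x).symm⟩
    | k + 3 => exact ⟨0, fun x => (h3 _ (by omega) x).symm⟩
  degree_one k d x hx := by
    match k with
    | 0 => rw [h0]; exact zero_mem _
    | 1 => rw [h1]; simpa using d1 (hx 0)
    | 2 => rw [h2]; simpa using d2 (hx 0) (hx 1)
    | k + 3 => rw [h3 _ (by omega)]; exact zero_mem _
  symm k d x hx σ := by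
    match k with
    | 0 => rw [h0, h0, smul_zero]
    | 1 => rw [Subsingleton.elim σ 1, koszulSign_one, one_smul]; rfl
    | 2 =>
      have hσ : σ = 1 ∨ σ = Equiv.swap 0 1 := by revert σ; decide
      rcases hσ with rfl | rfl
      · rw [koszulSign_one, one_smul]; rfl
      · rw [koszulSign_swap, h2, h2, mul_comm]
        simpa using s2 (hx 1) (hx 0)
    | k + 3 => rw [h3 _ (by omega), h3 _ (by omega), smul_zero]
  jacobi N d x hx := by
    -- This removes every term of the structure equations whose inner operation vanishes.
    have hz : ∀ (k : ℕ) (y : Fin (k + 1) → G), y 0 = 0 → l (k + 1) y = 0 := by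
      intro k y hy
      match k with
      | 0 => rw [h1, hy, map_zero]
      | 1 => rw [h2, hy, map_zero, LinearMap.zero_apply]
      | k + 2 => exact h3 _ (by omega) y
    have hc1 : ∀ (y : G) (r : Fin 0 → G), l 1 (Fin.cons y r) = l₁ y := fun y r => h1 _
    have hc2 : ∀ (y : G) (r : Fin 1 → G), l 2 (Fin.cons y r) = l₂ y (r 0) := fun y r => h2 _
    unfold jacobiator
    match N with
    | 0 =>
      refine Finset.sum_eq_zero fun i _ => Finset.sum_eq_zero fun σ _ => ?_
      obtain ⟨_ | i, hi⟩ := i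
      · split_ifs
        · exact (congrArg _ (hz _ _ (h0 _))).trans (smul_zero _)
        · rfl
      · omega
    | 1 =>
      rw [Fin.sum_univ_two]
      have e0 : ∀ σ : Equiv.Perm (Fin 1), IsShuffle (1 : Fin 2).1 σ := by
        unfold IsShuffle; decide
      rw [Finset.sum_eq_zero, zero_add, Fintype.sum_unique, if_pos (e0 _)]
      · change _ • l 1 (Fin.cons (l 1 _) _) = 0
        rw [hc1, h1, j1 (hx _), smul_zero]
      · intro σ _
        split_ifs
        · exact (congrArg _ (hz _ _ (h0 _))).trans (smul_zero _)
        · rfl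
    | 2 =>
      rw [Fin.sum_univ_three, Finset.sum_eq_zero, zero_add]
      · simp only [← Finset.sum_filter]
        have e1 : ∀ σ : Equiv.Perm (Fin 2),
            IsShuffle (1 : Fin 3).1 σ ↔ σ = 1 ∨ σ = Equiv.swap 0 1 := by
          unfold IsShuffle; decide
        have e2 : ∀ σ : Equiv.Perm (Fin 2), IsShuffle (2 : Fin 3).1 σ ↔ σ = 1 := by
          unfold IsShuffle; decide
        simp only [e1, e2, Finset.filter_or, Finset.filter_eq', Finset.mem_univ, if_true]
        rw [Finset.sum_union (by simp; decide), Finset.sum_singleton, Finset.sum_singleton,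
          Finset.sum_singleton, koszulSign_one, koszulSign_swap, one_smul, one_smul]
        change l 2 (Fin.cons (l 1 _) _) + _ • l 2 (Fin.cons (l 1 _) _) +
          l 1 (Fin.cons (l 2 _) _) = 0
        rw [hc2, hc2, hc1, h1, h1, h2]
        have := j2 (hx 0) (hx 1)
        rw [← this]
        change l₂ (l₁ (x 0)) (x 1) + _ • l₂ (l₁ (x 1)) (x 0) + l₁ (l₂ (x 0) (x 1)) = _
        abel
      · intro σ _
        split_ifs
        · exact (congrArg _ (hz _ _ (h0 _))).trans (smul_zero _)
        · rfl
    | 3 =>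
      -- Only `l_2(l_2(·, ·), ·)` survives: `i = 0` and `i = 3` have a zero inner operation, and `i
      -- = 1` has the outer operation `l_3`.
      rw [Finset.sum_eq_single 2]
      · simp only [← Finset.sum_filter]
        -- The three shuffles leave `z`, `y` and `x` outside the inner bracket, respectively.
        have e2 : ∀ σ : Equiv.Perm (Fin 3), IsShuffle (2 : Fin 4).1 σ ↔
            σ = 1 ∨ σ = Equiv.swap 1 2 ∨ σ = finRotate 3 := by
          unfold IsShuffle; decide
        simp only [e2, Finset.filter_or, Finset.filter_eq', Finset.mem_univ, if_true]
        rw [Finset.sum_union (by simp; decide), Finset.sum_union (by simp; decide),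
          Finset.sum_singleton, Finset.sum_singleton,
          Finset.sum_singleton, koszulSign_one, koszulSign_swap_one_two, koszulSign_finRotate,
          one_smul, ← add_assoc]
        change l 2 (Fin.cons (l 2 _) _) + _ • l 2 (Fin.cons (l 2 _) _) +
          _ • l 2 (Fin.cons (l 2 _) _) = 0
        rw [hc2, hc2, hc2, h2, h2, h2]
        exact j3 (hx 0) (hx 1) (hx 2)
      · intro i _ hi
        refine Finset.sum_eq_zero fun σ _ => ?_
        split_ifs
        · rw [(?_ : l _ _ = 0), smul_zero]
          fin_cases i
          · exact hz _ _ (h0 _)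
          · exact h3 _ (by decide) _
          · exact absurd rfl hi
          · exact hz _ _ (h3 _ (by decide) _)
        · rfl
      · simp
    | N + 4 =>
      refine Finset.sum_eq_zero fun i _ => Finset.sum_eq_zero fun σ _ => ?_
      split_ifs
      · rw [(?_ : l _ _ = 0), smul_zero]
        -- For at least four arguments, the inner or the outer operation has arity at least `3`.
        by_cases hi : 3 ≤ i.1
        · exact hz _ _ (h3 _ hi _)
        · exact h3 _ (by omega) _
      · rfl
  flat := h0

/-- Derived brackets of an element `m + n` of degree one with `[m, m] = [m, n] = [n, n] = 0` on an
abelian subspace `G` of a graded Lie algebra that contains `[m, G]` and `[[n, G], G]`. -/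
theorem IsGradedLie.isLInfty [CharZero K] {L : Type*} [AddCommGroup L] [Module K L]
    {𝒢L : ℤ → Submodule K L} {br : L →ₗ[K] L →ₗ[K] L} (H : IsGradedLie 𝒢L br)
    {𝒢 : ℤ → Submodule K G} (hint : DirectSum.IsInternal 𝒢) (i : G →ₗ[K] L)
    (hi : Function.Injective i) (hmem : ∀ {a x}, x ∈ 𝒢 a → i x ∈ 𝒢L a)
    (hcomm : ∀ x y, br (i x) (i y) = 0) {m n : L} (hm : m ∈ 𝒢L 1) (hn : n ∈ 𝒢L 1)
    (hmm : br m m = 0) (hmn : br m n = 0) (hnn : br n n = 0)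
    {l : (k : ℕ) → (Fin k → G) → G} (l₁ : G →ₗ[K] G) (l₂ : G →ₗ[K] G →ₗ[K] G)
    (h0 : ∀ x : Fin 0 → G, l 0 x = 0) (h1 : ∀ x : Fin 1 → G, l 1 x = l₁ (x 0))
    (h2 : ∀ x : Fin 2 → G, l 2 x = l₂ (x 0) (x 1))
    (h3 : ∀ k, 3 ≤ k → ∀ x : Fin k → G, l k x = 0)
    (d1 : ∀ {a x}, x ∈ 𝒢 a → l₁ x ∈ 𝒢 (a + 1))
    (d2 : ∀ {a b x y}, x ∈ 𝒢 a → y ∈ 𝒢 b → l₂ x y ∈ 𝒢 (a + b + 1))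
    (e1 : ∀ x, i (l₁ x) = br m (i x)) (e2 : ∀ x y, i (l₂ x y) = br (br n (i x)) (i y)) :
    IsLInfty 𝒢 l := by
  refine isLInfty_of_binary hint l₁ l₂ h0 h1 h2 h3 d1 d2 ?_ ?_ ?_ ?_
  · intro a b x y hx hy
    apply hi
    rw [Units.smul_def, map_zsmul, ← Units.smul_def, e2, e2]
    exact H.derived_symm hn (hmem hx) (hmem hy) (hcomm x y)
  · intro a x hx
    apply hi
    rw [e1, e1, map_zero]
    exact H.bracket_bracket_self hm (hmem hx) hmm
  · intro a b x y hx hy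
    apply hi
    simp only [Units.smul_def, map_add, map_zsmul, map_zero, e1, e2]
    exact H.derived_leibniz hm hn hmn (hmem hx) (hmem hy) (by rw [← e1]; exact hcomm _ _)
  · intro a b c x y z hx hy hz
    apply hi
    simp only [Units.smul_def, map_add, map_zsmul, map_zero, e2]
    exact H.derived_jacobi hn hnn (hmem hx) (hmem hy) (hmem hz)
      (by rw [← e2]; exact hcomm _ _) (by rw [← e2]; exact hcomm _ _)

end LInfinity

/-- The natural decomposition over `ℕ`, placed in the nonnegative degrees of `ℤ`, is inverse to the
sum map because the negative pieces are zero. -/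
theorem cochainGrading_isInternal {K V W : Type*} [Field K] [AddCommGroup V] [Module K V]
    [AddCommGroup W] [Module K W] : DirectSum.IsInternal (cochainGrading K V W) := by
  have hd : ∀ n : ℕ, ∀ f : Cochain K V W n,
      DirectSum.lof K ℕ (Cochain K V W) n f ∈ cochainGrading K V W (n : ℤ) :=
    fun _ f => lof_mem_cochainGrading f
  let dec : Cochains K V W →ₗ[K] DirectSum ℤ fun i => cochainGrading K V W i :=
    DirectSum.toModule K ℕ _ fun n => (DirectSum.lof K ℤ (fun i => cochainGrading K V W i) n).comp
      ((DirectSum.lof K ℕ (Cochain K V W) n).codRestrict _ (hd n))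
  have dec_lof : ∀ (n : ℕ) (f : Cochain K V W n), dec (DirectSum.lof K ℕ (Cochain K V W) n f) =
      DirectSum.lof K ℤ (fun i => cochainGrading K V W i) n ⟨_, hd n f⟩ := by
    intro n f
    simp only [dec, DirectSum.toModule_lof]
    rfl
  refine (DirectSum.Decomposition.ofLinearMap _ dec ?_ ?_).isInternal
  · refine DirectSum.linearMap_ext K fun n => LinearMap.ext fun f => ?_
    change DirectSum.coeLinearMap (cochainGrading K V W)
      (dec (DirectSum.lof K ℕ (Cochain K V W) n f)) = _
    rw [dec_lof]
    exact DirectSum.coeLinearMap_lof _ _ _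
  · refine DirectSum.linearMap_ext K fun i => LinearMap.ext fun x => ?_
    obtain ⟨x, hx⟩ := x
    change dec (DirectSum.coeLinearMap (cochainGrading K V W) (DirectSum.lof K ℤ _ i ⟨x, hx⟩)) =
      DirectSum.lof K ℤ _ i ⟨x, hx⟩
    rw [DirectSum.coeLinearMap_lof]
    rcases mem_cochainGrading_cases hx with rfl | ⟨n, f, rfl, rfl⟩
    · exact (map_zero _).trans (map_zero _).symm
    · exact dec_lof n f

theorem ofBilin_zero {K V W : Type*} [Field K] [AddCommGroup V] [Module K V] [AddCommGroup W]
    [Module K W] : ofBilin (0 : V →ₗ[K] V →ₗ[K] W) = 0 := rfl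

/-- Eigenvectors for distinct eigenvalues are independent; applying `T` twice to the relation `x +
2y + z = 0` gives a Vandermonde system. The form of `h` is that of `[μ + ν, μ + ν]` with its two
equal cross terms. -/
theorem eq_zero_of_eigenvectors {K V : Type*} [Field K] [CharZero K] [AddCommGroup V] [Module K V]
    {T : V →ₗ[K] V} {x y z : V} (hx : T x = (1 : K) • x) (hy : T y = (2 : K) • y)
    (hz : T z = (2 * 2 : K) • z) (h : x + y + (y + z) = 0) : x = 0 ∧ y = 0 ∧ z = 0 := by
  have h1 := congrArg T h
  simp only [map_add, map_zero, hx, hy, hz] at h1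
  have h2 := congrArg T h1
  simp only [map_add, map_zero, map_smul, hx, hy, hz] at h2
  have hz6 : (6 : K) • z = 0 := by
    linear_combination (norm := module) h2 - (3 : K) • h1 + (2 : K) • h
  obtain rfl : z = 0 := (smul_eq_zero.1 hz6).resolve_left (by norm_num)
  have hy2 : (2 : K) • y = 0 := by
    linear_combination (norm := module) h1 - h
  obtain rfl : y = 0 := (smul_eq_zero.1 hy2).resolve_left (by norm_num)
  exact ⟨by simpa using h, rfl, rfl⟩

/-! ### The controlling operations as derived brackets. -/

namespace QuasiTwilled

variable {K A B : Type*} [Field K] [AddCommGroup A] [Module K A] [AddCommGroup B] [Module K B]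

/-- The unary operation `f ↦ P[μ_{▷,◁}, f]` on `𝔞`. -/
def opOne (Q : QuasiTwilled K A B) : Cochains K A B →ₗ[K] Cochains K A B :=
  proj K A B ∘ₗ gerstenhaber K (A × B) Q.muElt ∘ₗ incl K A B

/-- The binary operation `(f, g) ↦ P[[ν_{⇀,↼}, f], g]` on `𝔞`. -/
def opTwo (Q : QuasiTwilled K A B) : Cochains K A B →ₗ[K] Cochains K A B →ₗ[K] Cochains K A B :=
  ((gerstenhaber K (A × B)).compl₁₂ (gerstenhaber K (A × B) Q.nuElt ∘ₗ incl K A B)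
    (incl K A B)).compr₂ (proj K A B)

theorem opOne_apply (Q : QuasiTwilled K A B) (f : Cochains K A B) :
    Q.opOne f = proj K A B (gerstenhaber K (A × B) Q.muElt (incl K A B f)) := rfl

theorem opTwo_apply (Q : QuasiTwilled K A B) (f g : Cochains K A B) :
    Q.opTwo f g = proj K A B
      (gerstenhaber K (A × B) (gerstenhaber K (A × B) Q.nuElt (incl K A B f)) (incl K A B g)) := rfl

theorem controllingOp_zero (Q : QuasiTwilled K A B) (x : Fin 0 → Cochains K A B) :
    Q.controllingOp 0 x = DirectSum.lof K ℕ (Cochain K A B) 1 (ofBilin Q.theta) := by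
  change proj K A B Q.omegaElt = _
  rw [omegaElt, proj_lof]
  congr 1
  ext v
  simp [ofBilin, thetaTilde, muAct, nuAct]

theorem incl_mem {a : ℤ} {f : Cochains K A B} (hf : f ∈ cochainGrading K A B a) :
    incl K A B f ∈ cochainGrading K (A × B) (A × B) a := by
  rcases mem_cochainGrading_cases hf with rfl | ⟨n, f, rfl, rfl⟩
  · simp
  · rw [incl_lof]
    exact lof_mem_cochainGrading _

theorem proj_mem {a : ℤ} {F : Cochains K (A × B) (A × B)}
    (hF : F ∈ cochainGrading K (A × B) (A × B) a) : proj K A B F ∈ cochainGrading K A B a := by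
  rcases mem_cochainGrading_cases hF with rfl | ⟨n, f, rfl, rfl⟩
  · simp
  · rw [proj_lof]
    exact lof_mem_cochainGrading _

theorem muElt_mem (Q : QuasiTwilled K A B) : Q.muElt ∈ cochainGrading K (A × B) (A × B) 1 :=
  lof_mem_cochainGrading (n := 1) _

theorem nuElt_mem (Q : QuasiTwilled K A B) : Q.nuElt ∈ cochainGrading K (A × B) (A × B) 1 :=
  lof_mem_cochainGrading (n := 1) _

theorem opOne_mem (Q : QuasiTwilled K A B) {a : ℤ} {f : Cochains K A B}
    (hf : f ∈ cochainGrading K A B a) : Q.opOne f ∈ cochainGrading K A B (a + 1) := by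
  rw [opOne_apply, add_comm]
  exact proj_mem (isGradedLie_gerstenhaber.mem Q.muElt_mem (incl_mem hf))

theorem opTwo_mem (Q : QuasiTwilled K A B) {a b : ℤ} {f g : Cochains K A B}
    (hf : f ∈ cochainGrading K A B a) (hg : g ∈ cochainGrading K A B b) :
    Q.opTwo f g ∈ cochainGrading K A B (a + b + 1) := by
  rw [opTwo_apply, show a + b + 1 = 1 + a + b by ring]
  exact proj_mem (isGradedLie_gerstenhaber.mem
    (isGradedLie_gerstenhaber.mem Q.nuElt_mem (incl_mem hf)) (incl_mem hg))

theorem incl_injective : Function.Injective (incl K A B) :=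
  Function.LeftInverse.injective proj_incl

theorem omega_apply (Q : QuasiTwilled K A B) (u v : A × B) :
    (Q.thetaTilde + Q.muAct + Q.nuAct) u v = Q.mul u v := by
  obtain ⟨a, x⟩ := u
  obtain ⟨b, y⟩ := v
  simp only [LinearMap.add_apply, thetaTilde_apply, muAct_apply, nuAct_apply,
    QuasiTwilledData.mul, Prod.mk_add_mk]
  refine Prod.ext ?_ ?_
  · change 0 + _ + (_ + _) = _ + _ + _
    abel
  · change _ + (_ + _) + _ = _ + _ + _ + _
    abel

theorem seqEval_ofBilin {V W : Type*} [AddCommGroup V] [Module K V] [AddCommGroup W] [Module K W]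
    (b : V →ₗ[K] V →ₗ[K] W) (v : ℕ → V) : seqEval (ofBilin b) v = b (v 0) (v 1) := rfl

/-- `Ω ⋄ Ω` is the associator `(u v) w - u (v w)`, the sign coming from insertion at the second
place. -/
theorem omegaElt_bracket (Q : QuasiTwilled K A B) :
    gerstenhaber K (A × B) Q.omegaElt Q.omegaElt = 0 := by
  have h : circ K (A × B) Q.omegaElt Q.omegaElt = 0 := by
    rw [omegaElt, circ_lof, ← map_zero (DirectSum.lof K ℕ (Cochain K (A × B) (A × B)) (1 + 1))]
    refine lof_eq_of_seqEval rfl _ _ fun v => ?_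
    rw [seqEval_diamond]
    simp only [seqEval_ofBilin, omega_apply, Finset.sum_range_succ, Finset.sum_range_zero]
    simp [insSeq, Q.assoc, seqEval]
  rw [omegaElt] at h ⊢
  rw [gerstenhaber_lof, h, smul_zero, sub_zero]

/-! ### Consequences of the weights: the operations, and the `L_∞` identities for `θ = 0`. -/

section Weights

variable [CharZero K]

theorem thetaElt_incl (Q : QuasiTwilled K A B) (f : Cochains K A B) :
    gerstenhaber K (A × B) Q.thetaElt (incl K A B f) = 0 := by
  have h := Q.thetaElt_hasWeight.gerstenhaber (incl_hasWeight f)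
  rw [show (2 : K)⁻¹ * 2⁻¹ = (2 ^ 2)⁻¹ by norm_num] at h
  exact h.eq_zero

theorem incl_incl (f g : Cochains K A B) :
    gerstenhaber K (A × B) (incl K A B f) (incl K A B g) = 0 := by
  have h := (incl_hasWeight f).gerstenhaber (incl_hasWeight g)
  rw [show (2 : K)⁻¹ * 2⁻¹ = (2 ^ 2)⁻¹ by norm_num] at h
  exact h.eq_zero

theorem incl_opOne (Q : QuasiTwilled K A B) (f : Cochains K A B) :
    incl K A B (Q.opOne f) = gerstenhaber K (A × B) Q.muElt (incl K A B f) := by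
  have h := Q.muElt_hasWeight.gerstenhaber (incl_hasWeight f)
  rw [one_mul] at h
  exact h.incl_proj

theorem nuElt_incl_hasWeight (Q : QuasiTwilled K A B) (f : Cochains K A B) :
    HasWeight (1 : K) (gerstenhaber K (A × B) Q.nuElt (incl K A B f)) := by
  have h := Q.nuElt_hasWeight.gerstenhaber (incl_hasWeight f)
  rwa [mul_inv_cancel₀ two_ne_zero] at h

theorem incl_opTwo (Q : QuasiTwilled K A B) (f g : Cochains K A B) :
    incl K A B (Q.opTwo f g) = gerstenhaber K (A × B)
      (gerstenhaber K (A × B) Q.nuElt (incl K A B f)) (incl K A B g) := by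
  have h := (Q.nuElt_incl_hasWeight f).gerstenhaber (incl_hasWeight g)
  rw [one_mul] at h
  exact h.incl_proj

theorem iterBracket_one (Q : QuasiTwilled K A B) (x : Fin 1 → Cochains K A B) :
    Q.iterBracket 1 x = gerstenhaber K (A × B) Q.muElt (incl K A B (x 0)) +
      gerstenhaber K (A × B) Q.nuElt (incl K A B (x 0)) := by
  change gerstenhaber K (A × B) Q.omegaElt (incl K A B (x 0)) = _
  rw [omegaElt_eq, map_add, map_add, LinearMap.add_apply, LinearMap.add_apply, thetaElt_incl,
    zero_add]

theorem iterBracket_two (Q : QuasiTwilled K A B) (x : Fin 2 → Cochains K A B) :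
    Q.iterBracket 2 x = incl K A B (Q.opTwo (x 0) (x 1)) := by
  change gerstenhaber K (A × B) (Q.iterBracket 1 fun i => x i.castSucc) (incl K A B (x 1)) = _
  rw [iterBracket_one, map_add, LinearMap.add_apply, ← incl_opOne, incl_incl, zero_add,
    incl_opTwo]
  rfl

theorem iterBracket_of_three_le (Q : QuasiTwilled K A B) {k : ℕ} (hk : 3 ≤ k)
    (x : Fin k → Cochains K A B) : Q.iterBracket k x = 0 := by
  induction k, hk using Nat.le_induction with
  | base =>
    change gerstenhaber K (A × B) (Q.iterBracket 2 _) (incl K A B _) = 0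
    rw [iterBracket_two, incl_incl]
  | succ k _ ih =>
    change gerstenhaber K (A × B) (Q.iterBracket k _) (incl K A B _) = 0
    rw [ih, map_zero, LinearMap.zero_apply]

theorem controllingOp_one (Q : QuasiTwilled K A B) (x : Fin 1 → Cochains K A B) :
    Q.controllingOp 1 x = Q.opOne (x 0) := by
  rw [controllingOp, iterBracket_one, map_add, (Q.nuElt_incl_hasWeight _).proj_eq_zero, add_zero,
    opOne_apply]

theorem controllingOp_two (Q : QuasiTwilled K A B) (x : Fin 2 → Cochains K A B) :
    Q.controllingOp 2 x = Q.opTwo (x 0) (x 1) := by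
  rw [controllingOp, iterBracket_two, proj_incl]

theorem controllingOp_of_three_le (Q : QuasiTwilled K A B) {k : ℕ} (hk : 3 ≤ k)
    (x : Fin k → Cochains K A B) : Q.controllingOp k x = 0 := by
  rw [controllingOp, Q.iterBracket_of_three_le hk, map_zero]

/-- Without `θ~`, the three brackets in `[Ω, Ω] = 0` have the distinct weights `1`, `2` and `4`, so
each vanishes. -/
theorem bracket_relations (Q : QuasiTwilled K A B) (hθ : Q.theta = 0) :
    gerstenhaber K (A × B) Q.muElt Q.muElt = 0 ∧ gerstenhaber K (A × B) Q.muElt Q.nuElt = 0 ∧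
      gerstenhaber K (A × B) Q.nuElt Q.nuElt = 0 := by
  have hT : Q.thetaElt = 0 := by
    have h : Q.thetaTilde = 0 := by
      rw [thetaTilde, hθ]
      ext <;> simp
    rw [thetaElt, h, ofBilin_zero, map_zero]
  have hO := Q.omegaElt_bracket
  have hs : gerstenhaber K (A × B) Q.nuElt Q.muElt = gerstenhaber K (A × B) Q.muElt Q.nuElt := by
    rw [isGradedLie_gerstenhaber.antisymm Q.nuElt_mem Q.muElt_mem, mul_one, Int.negOnePow_one,
      Units.neg_smul, one_smul, neg_neg]
  rw [omegaElt_eq, hT, zero_add] at hO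
  simp only [map_add, LinearMap.add_apply, hs] at hO
  have h1 := Q.muElt_hasWeight.gerstenhaber Q.muElt_hasWeight
  have h2 := Q.muElt_hasWeight.gerstenhaber Q.nuElt_hasWeight
  have h3 := Q.nuElt_hasWeight.gerstenhaber Q.nuElt_hasWeight
  rw [one_mul] at h1 h2
  exact eq_zero_of_eigenvectors h1 h2 h3 hO

theorem isLInfty_controllingOp (Q : QuasiTwilled K A B) (hθ : Q.theta = 0) :
    IsLInfty (cochainGrading K A B) Q.controllingOp := by
  obtain ⟨hmm, hmn, hnn⟩ := Q.bracket_relations hθ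
  refine isGradedLie_gerstenhaber.isLInfty cochainGrading_isInternal (incl K A B) incl_injective
    incl_mem incl_incl Q.muElt_mem Q.nuElt_mem hmm hmn hnn Q.opOne Q.opTwo (fun x => ?_)
    Q.controllingOp_one Q.controllingOp_two (fun k hk x => Q.controllingOp_of_three_le hk x)
    Q.opOne_mem Q.opTwo_mem Q.incl_opOne Q.incl_opTwo
  rw [controllingOp_zero, hθ, ofBilin_zero, map_zero]

end Weights

end QuasiTwilled

/-! ### Twisting when all operations of arity at least three vanish. -/

section Twist

variable {K : Type*} [Field K] {G : Type*} [AddCommGroup G] [Module K G]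
  {l : (k : ℕ) → (Fin k → G) → G}

theorem twist_zero (l₁ : G →ₗ[K] G) (l₂ : G →ₗ[K] G →ₗ[K] G)
    (h1 : ∀ x : Fin 1 → G, l 1 x = l₁ (x 0))
    (h2 : ∀ x : Fin 2 → G, l 2 x = l₂ (x 0) (x 1))
    (h3 : ∀ k, 3 ≤ k → ∀ x : Fin k → G, l k x = 0) (α : G) (x : Fin 0 → G) :
    twist K l α 0 x = l 0 x + l₁ α + (2 : K)⁻¹ • l₂ α α := by
  unfold twist
  rw [finsum_eq_sum_of_support_subset (s := Finset.range 3)]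
  · rw [Finset.sum_range_succ, Finset.sum_range_succ, Finset.sum_range_one]
    have e0 : l (0 + 0) (Fin.append (fun _ : Fin 0 => α) x) = l 0 x :=
      congrArg (l 0) (Subsingleton.elim _ _)
    have e1 : l (1 + 0) (Fin.append (fun _ : Fin 1 => α) x) = l₁ α := h1 _
    have e2 : l (2 + 0) (Fin.append (fun _ : Fin 2 => α) x) = l₂ α α := h2 _
    rw [e0, e1, e2]
    simp
  · intro n hn
    by_contra h
    rw [Finset.coe_range, Set.mem_Iio, not_lt] at h
    exact hn (by beta_reduce; rw [h3 _ (by omega), smul_zero])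

theorem twist_one (l₁ : G →ₗ[K] G) (l₂ : G →ₗ[K] G →ₗ[K] G) (h1 : ∀ x : Fin 1 → G, l 1 x = l₁ (x 0))
    (h2 : ∀ x : Fin 2 → G, l 2 x = l₂ (x 0) (x 1))
    (h3 : ∀ k, 3 ≤ k → ∀ x : Fin k → G, l k x = 0) (α : G) (x : Fin 1 → G) :
    twist K l α 1 x = l₁ (x 0) + l₂ α (x 0) := by
  unfold twist
  rw [finsum_eq_sum_of_support_subset (s := Finset.range 2)]
  · rw [Finset.sum_range_succ, Finset.sum_range_one]
    have e0 : l (0 + 1) (Fin.append (fun _ : Fin 0 => α) x) = l₁ (x 0) := h1 _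
    have e1 : l (1 + 1) (Fin.append (fun _ : Fin 1 => α) x) = l₂ α (x 0) := h2 _
    rw [e0, e1]
    simp
  · intro n hn
    by_contra h
    rw [Finset.coe_range, Set.mem_Iio, not_lt] at h
    exact hn (by beta_reduce; rw [h3 _ (by omega), smul_zero])

theorem twist_two (l₂ : G →ₗ[K] G →ₗ[K] G) (h2 : ∀ x : Fin 2 → G, l 2 x = l₂ (x 0) (x 1))
    (h3 : ∀ k, 3 ≤ k → ∀ x : Fin k → G, l k x = 0) (α : G) (x : Fin 2 → G) :
    twist K l α 2 x = l₂ (x 0) (x 1) := by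
  unfold twist
  rw [finsum_eq_sum_of_support_subset (s := Finset.range 1)]
  · rw [Finset.sum_range_one]
    have e0 : l (0 + 2) (Fin.append (fun _ : Fin 0 => α) x) = l₂ (x 0) (x 1) := h2 _
    rw [e0]
    simp
  · intro n hn
    by_contra h
    rw [Finset.coe_range, Set.mem_Iio, not_lt] at h
    exact hn (by beta_reduce; rw [h3 _ (by omega), smul_zero])

theorem twist_of_three_le (h3 : ∀ k, 3 ≤ k → ∀ x : Fin k → G, l k x = 0) (α : G) {k : ℕ}
    (hk : 3 ≤ k) (x : Fin k → G) : twist K l α k x = 0 := by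
  unfold twist
  rw [finsum_eq_zero_of_forall_eq_zero]
  intro n
  rw [h3 _ (by omega), smul_zero]

theorem finsum_maurerCartan (l₁ : G →ₗ[K] G) (l₂ : G →ₗ[K] G →ₗ[K] G)
    (h1 : ∀ x : Fin 1 → G, l 1 x = l₁ (x 0)) (h2 : ∀ x : Fin 2 → G, l 2 x = l₂ (x 0) (x 1))
    (h3 : ∀ k, 3 ≤ k → ∀ x : Fin k → G, l k x = 0) (α : G) :
    ∑ᶠ k : ℕ, ((k ! : ℕ) : K)⁻¹ • l k (fun _ => α) =
      l 0 ![] + l₁ α + (2 : K)⁻¹ • l₂ α α := by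
  rw [← twist_zero l₁ l₂ h1 h2 h3 α ![], twist]
  refine finsum_congr fun n => ?_
  congr 2
  funext i
  exact (Fin.append_left (fun _ : Fin n => α) ![] i).symm

/-- This is the Taylor expansion of a quadratic map at its zero `α`: symmetry merges the two cross
terms and cancels the `½`. -/
theorem maurerCartan_add_iff [CharZero K] (l₁ : G →ₗ[K] G) (l₂ : G →ₗ[K] G →ₗ[K] G) {c α β : G}
    (h : c + l₁ α + (2 : K)⁻¹ • l₂ α α = 0) (hs : l₂ α β = l₂ β α) :
    c + l₁ (α + β) + (2 : K)⁻¹ • l₂ (α + β) (α + β) = 0 ↔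
      0 + (l₁ β + l₂ α β) + (2 : K)⁻¹ • l₂ β β = 0 := by
  have e : c + l₁ (α + β) + (2 : K)⁻¹ • l₂ (α + β) (α + β) =
      (c + l₁ α + (2 : K)⁻¹ • l₂ α α) + (0 + (l₁ β + l₂ α β) + (2 : K)⁻¹ • l₂ β β) := by
    simp only [map_add, LinearMap.add_apply, ← hs]
    match_scalars <;> norm_num
  rw [e, h, zero_add]

end Twist

/-! ### The bracket of a bilinear map with a linear map. -/

section Derivation

variable {K : Type*} [Field K] {V : Type*} [AddCommGroup V] [Module K V]

/-- The bilinear map `(u, v) ↦ b(e u, v) + b(u, e v) - e b(u, v)`. -/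
def deriveBilin (b : V →ₗ[K] V →ₗ[K] V) (e : V →ₗ[K] V) : V →ₗ[K] V →ₗ[K] V :=
  b.comp e + b.compl₂ e - b.compr₂ e

theorem deriveBilin_apply (b : V →ₗ[K] V →ₗ[K] V) (e : V →ₗ[K] V) (u v : V) :
    deriveBilin b e u v = b (e u) v + b u (e v) - e (b u v) := rfl

theorem gerstenhaber_ofBilin_ofLin (b : V →ₗ[K] V →ₗ[K] V) (e : V →ₗ[K] V) :
    gerstenhaber K V (DirectSum.lof K ℕ (Cochain K V V) 1 (ofBilin b))
        (DirectSum.lof K ℕ (Cochain K V V) 0 (ofLin e)) =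
      DirectSum.lof K ℕ (Cochain K V V) 1 (ofBilin (deriveBilin b e)) := by
  rw [gerstenhaber_lof, circ_lof, circ_lof, mul_zero, pow_zero, one_smul]
  change DirectSum.lof K ℕ (Cochain K V V) 1 _ - DirectSum.lof K ℕ (Cochain K V V) 1 _ = _
  rw [← map_sub]
  refine lof_eq_of_seqEval rfl _ _ fun v => ?_
  change seqEval (diamond K V 1 0 (ofBilin b) (ofLin e)) v -
    seqEval (diamond K V 0 1 (ofLin e) (ofBilin b)) v = _
  have hl : ∀ w : ℕ → V, seqEval (ofLin e) w = e (w 0) := fun _ => rfl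
  rw [seqEval_diamond, seqEval_diamond]
  simp only [QuasiTwilled.seqEval_ofBilin, hl, Finset.sum_range_succ, Finset.sum_range_zero,
    deriveBilin_apply]
  simp [insSeq]

end Derivation

/-! ### Deformation by `D`, the Maurer-Cartan equation and the Hochschild differential. -/

namespace QuasiTwilled

variable {K A B : Type*} [Field K] [AddCommGroup A] [Module K A] [AddCommGroup B] [Module K B]

/-- `D : A → B` as an endomorphism `(a, x) ↦ (0, D a)` of `A ⊕ B`. -/
def extLin (D : A →ₗ[K] B) : (A × B) →ₗ[K] (A × B) :=
  LinearMap.inr K A B ∘ₗ D ∘ₗ LinearMap.fst K A B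

theorem extLin_apply (D : A →ₗ[K] B) (u : A × B) : extLin D u = (0, D u.1) := rfl

theorem incl_degZero (D : A →ₗ[K] B) : incl K A B (degZero D) =
    DirectSum.lof K ℕ (Cochain K (A × B) (A × B)) 0 (ofLin (extLin D)) := by
  rw [degZero, incl_lof]
  rfl

theorem degZero_add (D E : A →ₗ[K] B) : degZero (D + E) = degZero D + degZero E := by
  rw [degZero, degZero, degZero, ← map_add]
  rfl

theorem degZero_mem (D : A →ₗ[K] B) : degZero D ∈ cochainGrading K A B 0 :=
  lof_mem_cochainGrading (n := 0) _

theorem proj_lof_ofBilin (b : (A × B) →ₗ[K] (A × B) →ₗ[K] (A × B)) :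
    proj K A B (DirectSum.lof K ℕ (Cochain K (A × B) (A × B)) 1 (ofBilin b)) =
      DirectSum.lof K ℕ (Cochain K A B) 1 (ofBilin ((b.compl₁₂ (LinearMap.inl K A B)
        (LinearMap.inl K A B)).compr₂ (LinearMap.snd K A B))) := by
  rw [proj_lof]
  rfl

/-- The Maurer-Cartan equation of the controlling algebra. -/
theorem isStrongDeformationMap_iff [CharZero K] (Q : QuasiTwilled K A B) (D : A →ₗ[K] B) :
    Q.IsStrongDeformationMap D ↔ Q.controllingOp 0 ![] + Q.opOne (degZero D) +
      (2 : K)⁻¹ • Q.opTwo (degZero D) (degZero D) = 0 := by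
  have h1 : Q.opOne (degZero D) = DirectSum.lof K ℕ (Cochain K A B) 1 (ofBilin
      (((deriveBilin Q.muAct (extLin D)).compl₁₂ (LinearMap.inl K A B)
        (LinearMap.inl K A B)).compr₂ (LinearMap.snd K A B))) := by
    rw [opOne_apply, incl_degZero, muElt, gerstenhaber_ofBilin_ofLin, proj_lof_ofBilin]
  have h2 : Q.opTwo (degZero D) (degZero D) = DirectSum.lof K ℕ (Cochain K A B) 1 (ofBilin
      (((deriveBilin (deriveBilin Q.nuAct (extLin D)) (extLin D)).compl₁₂ (LinearMap.inl K A B)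
        (LinearMap.inl K A B)).compr₂ (LinearMap.snd K A B))) := by
    rw [opTwo_apply, incl_degZero, nuElt, gerstenhaber_ofBilin_ofLin, gerstenhaber_ofBilin_ofLin,
      proj_lof_ofBilin]
  have hinj : Function.Injective (DirectSum.lof K ℕ (Cochain K A B) 1) :=
    DirectSum.of_injective 1
  rw [h1, h2, controllingOp_zero, ← map_smul, ← map_add, ← map_add,
    ← map_zero (DirectSum.lof K ℕ (Cochain K A B) 1),
    hinj.eq_iff]
  -- As the endomorphism `e = extLin D` squares to zero, `[[ν, e], e]` is twice `ν(e u, e v) - e ν(e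
  -- u, v) - e ν(u, e v)`, and the `½` cancels.
  have key : ∀ a b : A, Q.theta a b + (deriveBilin Q.muAct (extLin D) (a, 0) (b, 0)).2 +
      (2 : K)⁻¹ • (deriveBilin (deriveBilin Q.nuAct (extLin D)) (extLin D) (a, 0) (b, 0)).2 =
      Q.mulB (D a) (D b) + Q.lactB a (D b) + Q.ractB (D a) b + Q.theta a b -
        D (Q.mulA a b + Q.ractA a (D b) + Q.lactA (D a) b) := by
    intro a b
    simp only [deriveBilin_apply, extLin_apply, muAct_apply, nuAct_apply, map_zero,
      LinearMap.zero_apply, Prod.snd_add, Prod.snd_sub, map_add, add_zero, zero_add, sub_zero,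
      map_sub]
    match_scalars <;> norm_num
  constructor
  · intro h
    ext v
    exact (key (v 0) (v 1)).trans (sub_eq_zero.2 (h _ _).symm)
  · intro h a b
    have := (key a b).symm.trans (congrArg (fun f : Cochain K A B 1 => f ![a, b]) h)
    exact (sub_eq_zero.1 this).symm

/-- The quasi-twilled structure conjugated by the automorphism `(a, x) ↦ (a, x + D a)`. -/
def deform (Q : QuasiTwilled K A B) (D : A →ₗ[K] B) (hD : Q.IsStrongDeformationMap D) :
    QuasiTwilled K A B where
  mulA := Q.mulD D
  mulB := Q.mulB
  lactB := Q.lactD D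
  ractB := Q.ractD D
  lactA := Q.lactA
  ractA := Q.ractA
  theta := 0
  assoc := by
    let ψ : A × B → A × B := fun u => (u.1, u.2 + D u.1)
    have hψ : Function.Injective ψ := fun u v h => by
      have h1 := congrArg Prod.fst h
      have h2 := congrArg Prod.snd h
      change u.1 = v.1 at h1
      change u.2 + D u.1 = v.2 + D v.1 at h2
      rw [h1] at h2
      exact Prod.ext h1 (add_right_cancel h2)
    let T : QuasiTwilledData K A B :=
      { mulA := Q.mulD D, mulB := Q.mulB, lactB := Q.lactD D, ractB := Q.ractD D,
        lactA := Q.lactA, ractA := Q.ractA, theta := 0 }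
    -- Associativity is transported along the injective `ψ`. The equation for `D` enters only in the
    -- `B`-component, where it accounts for `θ` being replaced by zero.
    have hmul : ∀ u v, ψ (T.mul u v) = Q.mul (ψ u) (ψ v) := by
      intro u v
      have h := hD u.1 v.1
      simp only [map_add] at h
      refine Prod.ext ?_ ?_
      · simp only [ψ, T, QuasiTwilledData.mul, mulD, LinearMap.add_apply, LinearMap.compl₂_apply,
          LinearMap.comp_apply, map_add]
        abel
      · simp only [ψ, T, QuasiTwilledData.mul, mulD, lactD, ractD, LinearMap.add_apply,
          LinearMap.sub_apply, LinearMap.compl₂_apply, LinearMap.compr₂_apply,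
          LinearMap.comp_apply, map_add, LinearMap.zero_apply]
        linear_combination (norm := abel) h
    intro u v w
    change T.mul (T.mul u v) w = T.mul u (T.mul v w)
    apply hψ
    rw [hmul, hmul, hmul, hmul, Q.assoc]

theorem muElt_deform (Q : QuasiTwilled K A B) (D : A →ₗ[K] B) (hD : Q.IsStrongDeformationMap D) :
    (Q.deform D hD).muElt = Q.muElt + gerstenhaber K (A × B) Q.nuElt (incl K A B (degZero D)) := by
  rw [incl_degZero, nuElt, gerstenhaber_ofBilin_ofLin, muElt, muElt, ← map_add]
  congr 1
  ext1 v
  change (Q.deform D hD).muAct (v 0) (v 1) =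
    Q.muAct (v 0) (v 1) + deriveBilin Q.nuAct (extLin D) (v 0) (v 1)
  obtain ⟨a, x⟩ := v 0
  obtain ⟨b, y⟩ := v 1
  simp only [deriveBilin_apply, extLin_apply, muAct_apply, nuAct_apply, deform, mulD, lactD,
    ractD, LinearMap.add_apply, LinearMap.sub_apply, LinearMap.compl₂_apply,
    LinearMap.compr₂_apply, LinearMap.comp_apply, map_zero, LinearMap.zero_apply]
  refine Prod.ext ?_ ?_
  · simp only [Prod.fst_add, Prod.fst_sub]
    abel
  · simp only [Prod.snd_add, Prod.snd_sub, map_add]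
    abel

theorem opOne_deform (Q : QuasiTwilled K A B) (D : A →ₗ[K] B) (hD : Q.IsStrongDeformationMap D)
    (f : Cochains K A B) : (Q.deform D hD).opOne f = Q.opOne f + Q.opTwo (degZero D) f := by
  rw [opOne_apply, muElt_deform, map_add, LinearMap.add_apply, map_add, opOne_apply, opTwo_apply]

theorem opTwo_deform (Q : QuasiTwilled K A B) (D : A →ₗ[K] B) (hD : Q.IsStrongDeformationMap D) :
    (Q.deform D hD).opTwo = Q.opTwo := rfl

theorem seqEval_proj {n : ℕ} (F : Cochain K (A × B) (A × B) n) (v : ℕ → A) :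
    seqEval ((LinearMap.snd K A B).compMultilinearMap
      (F.compLinearMap fun _ => LinearMap.inl K A B)) v = (seqEval F fun j => (v j, 0)).2 := rfl

theorem seqEval_incl {n : ℕ} (f : Cochain K A B n) (v : ℕ → A × B) :
    seqEval ((LinearMap.inr K A B).compMultilinearMap
      (f.compLinearMap fun _ => LinearMap.fst K A B)) v = (0, seqEval f fun j => (v j).1) := rfl

theorem seqEval_hochschild {V W : Type*} [AddCommGroup V] [Module K V] [AddCommGroup W]
    [Module K W] (mul : V →ₗ[K] V →ₗ[K] V) (lact : V →ₗ[K] W →ₗ[K] W) (ract : W →ₗ[K] V →ₗ[K] W)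
    {n : ℕ} (f : Cochain K V W n) (v : ℕ → V) :
    seqEval (hochschild mul lact ract f) v =
      lact (v 0) (seqEval f fun j => v (1 + j)) +
      ∑ i ∈ Finset.range (n + 1), (-1 : K) ^ (i + 1) •
        seqEval f (insSeq i 1 (mul (v i) (v (i + 1))) v) +
      (-1 : K) ^ n • ract (seqEval f v) (v (n + 1)) := by
  rw [seqEval, hochschild_apply, Finset.sum_range]
  refine congrArg₂ (· + ·) (congrArg₂ (· + ·) ?_ ?_) ?_
  · congr 2
    funext j
    simp [add_comm]
  · refine Finset.sum_congr rfl fun i _ => ?_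
    congr 2
    funext j
    by_cases h1 : j < i
    · simp [insSeq, h1]
    · by_cases h2 : j = i
      · subst h2; simp [insSeq]
      · have h3 : j.1 ≠ i.1 := fun e => h2 (Fin.ext e)
        have h4 : ¬ j.1 < i.1 := h1
        simp [insSeq, h1, h2, h3, h4]
  -- A cochain of degree `n` has `n + 1` arguments, so its last Hochschild sign is `(-1)^(n + 2)`.
  · rw [pow_add (-1 : K) n 2, neg_one_sq, mul_one]
    rfl

/-- The two insertions of `f` into `μ` are the outer Hochschild terms, and the insertions of `μ`
into `f` are the inner ones. `P` restricts to arguments in `A`, so only `·_A` remains in the latter.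
-/
theorem opOne_lof (Q : QuasiTwilled K A B) {n : ℕ} (f : Cochain K A B n) :
    Q.opOne (DirectSum.lof K ℕ (Cochain K A B) n f) = (-1 : K) ^ n •
      DirectSum.lof K ℕ (Cochain K A B) (n + 1) (hochschild Q.mulA Q.lactB Q.ractB f) := by
  rw [opOne_apply, incl_lof, muElt, gerstenhaber_lof, circ_lof, circ_lof, map_sub, map_smul,
    proj_lof, proj_lof]
  -- `μ ⋄ f` has degree `1 + n` and `f ⋄ μ` has degree `n + 1`; `g` is the first moved to the second
  -- degree.
  obtain ⟨g, hg, hg'⟩ := exists_lof_eq (add_comm 1 n) ((LinearMap.snd K A B).compMultilinearMap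
    ((diamond K (A × B) 1 n (ofBilin Q.muAct) ((LinearMap.inr K A B).compMultilinearMap
      (f.compLinearMap fun _ => LinearMap.fst K A B))).compLinearMap fun _ => LinearMap.inl K A B))
  rw [hg, ← map_smul, ← map_smul, ← map_sub]
  refine lof_eq_of_seqEval rfl _ _ fun v => ?_
  have key : ∀ (F : Cochain K A B (n + 1)), seqEval g v - (-1 : K) ^ (1 * n) • seqEval F v =
      (-1 : K) ^ n • seqEval (hochschild Q.mulA Q.lactB Q.ractB f) v →
      seqEval (g - (-1 : K) ^ (1 * n) • F) v =
        seqEval ((-1 : K) ^ n • hochschild Q.mulA Q.lactB Q.ractB f) v := fun _ h => h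
  apply key
  rw [hg', seqEval_proj, seqEval_proj, seqEval_diamond, seqEval_diamond, seqEval_hochschild,
    Finset.sum_range_succ, Finset.sum_range_one]
  have hfst : ∀ (i p : ℕ) (y : A × B),
      (fun j => (insSeq i p y (fun j => (v j, (0 : B))) j).1) = insSeq i p y.1 v := by
    intro i p y
    funext j
    simp only [insSeq, apply_ite Prod.fst]
  have e0 : ∀ y : A × B, insSeq 0 n y (fun j => (v j, (0 : B))) 0 = y ∧
      insSeq 0 n y (fun j => (v j, (0 : B))) 1 = (v (n + 1), 0) ∧
      insSeq 1 n y (fun j => (v j, (0 : B))) 0 = (v 0, 0) ∧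
      insSeq 1 n y (fun j => (v j, (0 : B))) 1 = y := by
    intro y
    simp [insSeq, add_comm]
  simp only [seqEval_ofBilin, seqEval_incl, e0, hfst, muAct_apply, Prod.snd_add, Prod.smul_snd,
    Prod.snd_sum, map_zero, LinearMap.zero_apply, add_zero, zero_add, zero_mul, pow_zero, one_smul,
    one_mul, mul_one]
  -- Insertion at place `i` carries `(-1)^i`, the Hochschild term `(-1)^(i + 1)`; the bracket's
  -- minus sign makes up the difference.
  have e1 : ∑ i ∈ Finset.range (n + 1), (-1 : K) ^ (i + 1) •
      seqEval f (insSeq i 1 (Q.mulA (v i) (v (i + 1))) v) = -∑ i ∈ Finset.range (n + 1),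
        (-1 : K) ^ i • seqEval f (insSeq i 1 (Q.mulA (v i) (v (i + 1))) v) := by
    rw [← Finset.sum_neg_distrib]
    refine Finset.sum_congr rfl fun i _ => ?_
    rw [pow_succ, mul_neg_one, neg_smul]
  rw [e1, smul_add, smul_add, smul_neg, smul_smul, ← pow_add, ← two_mul,
    (even_two_mul n).neg_one_pow, one_smul]
  abel

/-- In arity zero this is the Maurer-Cartan equation of `D` against the vanishing `θ` of the
deformed structure, in arity one it is `μ + [ν, D]`, and above that `D` has no effect. -/
theorem governingOp_eq [CharZero K] (Q : QuasiTwilled K A B) (D : A →ₗ[K] B)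
    (hD : Q.IsStrongDeformationMap D) : Q.governingOp D = (Q.deform D hD).controllingOp := by
  have h3 := fun (k : ℕ) (hk : 3 ≤ k) (x : Fin k → Cochains K A B) =>
    Q.controllingOp_of_three_le hk x
  funext k x
  rw [governingOp]
  match k with
  | 0 =>
    rw [twist_zero Q.opOne Q.opTwo Q.controllingOp_one Q.controllingOp_two h3,
      Subsingleton.elim x ![], (Q.isStrongDeformationMap_iff D).1 hD, controllingOp_zero]
    exact (map_zero _).symm
  | 1 =>
    rw [twist_one Q.opOne Q.opTwo Q.controllingOp_one Q.controllingOp_two h3, controllingOp_one,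
      opOne_deform]
  | 2 =>
    rw [twist_two Q.opTwo Q.controllingOp_two h3, controllingOp_two, opTwo_deform]
  | k + 3 =>
    rw [twist_of_three_le h3 _ (by omega), controllingOp_of_three_le _ (by omega)]

theorem opTwo_degZero_comm [CharZero K] (Q : QuasiTwilled K A B) (D E : A →ₗ[K] B) :
    Q.opTwo (degZero D) (degZero E) = Q.opTwo (degZero E) (degZero D) := by
  apply incl_injective
  rw [incl_opTwo, incl_opTwo, isGradedLie_gerstenhaber.derived_symm Q.nuElt_mem
    (incl_mem (degZero_mem D)) (incl_mem (degZero_mem E)) (incl_incl _ _), mul_zero,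
    Int.negOnePow_zero, one_smul]

end QuasiTwilled

end

theorem mainTheorem6 {K A B : Type*} [Field K] [CharZero K] [AddCommGroup A] [Module K A]
    [AddCommGroup B] [Module K B] (Q : QuasiTwilled K A B) (D : A →ₗ[K] B)
    (hD : Q.IsStrongDeformationMap D) :
    -- the operations `l_k` of the controlling algebra
    (Q.controllingOp 0 ![] = DirectSum.lof K ℕ (Cochain K A B) 1 (ofBilin Q.theta) ∧
      (∀ f : Cochains K A B, QuasiTwilled.incl K A B (Q.controllingOp 1 ![f]) =
        gerstenhaber K (A × B) (DirectSum.lof K ℕ (Cochain K (A × B) (A × B)) 1 (ofBilin Q.muAct))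
          (QuasiTwilled.incl K A B f)) ∧
      (∀ f g : Cochains K A B, QuasiTwilled.incl K A B (Q.controllingOp 2 ![f, g]) =
        gerstenhaber K (A × B)
          (gerstenhaber K (A × B)
            (DirectSum.lof K ℕ (Cochain K (A × B) (A × B)) 1 (ofBilin Q.nuAct))
            (QuasiTwilled.incl K A B f))
          (QuasiTwilled.incl K A B g)) ∧
      (∀ k : ℕ, 3 ≤ k → ∀ x : Fin k → Cochains K A B, Q.controllingOp k x = 0)) ∧
    -- the twisted operations form an `L_∞`-algebra and are given by the stated formulas
    IsLInfty (cochainGrading K A B) (Q.governingOp D) ∧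
    (∀ f : Cochains K A B, Q.governingOp D 1 ![f] =
      Q.controllingOp 1 ![f] + Q.controllingOp 2 ![QuasiTwilled.degZero D, f]) ∧
    (∀ f g : Cochains K A B, Q.governingOp D 2 ![f, g] = Q.controllingOp 2 ![f, g]) ∧
    (∀ k : ℕ, 3 ≤ k → ∀ x : Fin k → Cochains K A B, Q.governingOp D k x = 0) ∧
    -- `D + D'` is a strong deformation map iff `D'` is a Maurer-Cartan element
    (∀ D' : A →ₗ[K] B, Q.IsStrongDeformationMap (D + D') ↔
      IsMaurerCartan (cochainGrading K A B) (Q.governingOp D) (QuasiTwilled.degZero D')) ∧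
    -- `l_1^D = (-1)^{n-1} δ^D` on `Hom(A^{⊗ n}, B)`, with `n` written as `n + 1`
    (∀ (n : ℕ) (f : MultilinearMap K (fun _ : Fin (n + 1) => A) B),
      Q.governingOp D 1 ![DirectSum.lof K ℕ (Cochain K A B) n f] =
        (-1 : K) ^ n • DirectSum.lof K ℕ (Cochain K A B) (n + 1) (Q.deltaD D f)) := by
  have hg := Q.governingOp_eq D hD
  have hθ : (Q.deform D hD).theta = 0 := rfl
  refine ⟨⟨Q.controllingOp_zero _, fun f => ?_, fun f g => ?_,
    fun k hk x => Q.controllingOp_of_three_le hk x⟩, ?_, fun f => ?_, fun f g => ?_,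
    fun k hk x => ?_, fun E => ?_, fun n f => ?_⟩
  · rw [Q.controllingOp_one]
    exact Q.incl_opOne f
  · rw [Q.controllingOp_two]
    exact Q.incl_opTwo f g
  · rw [hg]
    exact (Q.deform D hD).isLInfty_controllingOp hθ
  · rw [hg, QuasiTwilled.controllingOp_one, QuasiTwilled.controllingOp_one,
      QuasiTwilled.controllingOp_two]
    exact Q.opOne_deform D hD f
  · rw [hg, QuasiTwilled.controllingOp_two, QuasiTwilled.controllingOp_two]
    rfl
  · rw [hg, QuasiTwilled.controllingOp_of_three_le _ hk]
  · rw [hg, IsMaurerCartan, and_iff_right (QuasiTwilled.degZero_mem E),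
      finsum_maurerCartan (Q.deform D hD).opOne (Q.deform D hD).opTwo
        (Q.deform D hD).controllingOp_one (Q.deform D hD).controllingOp_two
        (fun k hk x => (Q.deform D hD).controllingOp_of_three_le hk x),
      Q.isStrongDeformationMap_iff, QuasiTwilled.degZero_add, QuasiTwilled.opOne_deform,
      QuasiTwilled.opTwo_deform]
    have h0 := (Q.isStrongDeformationMap_iff D).1 hD
    have h1 : (Q.deform D hD).controllingOp 0 ![] = 0 := by
      rw [QuasiTwilled.controllingOp_zero, hθ, ofBilin_zero, map_zero]
    have h2 := Q.opTwo_degZero_comm D E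
    rw [h1]
    exact maurerCartan_add_iff Q.opOne Q.opTwo h0 h2
  · rw [hg, QuasiTwilled.controllingOp_one]
    -- The product and actions of the deformed structure are `·_D`, `▷_D` and `◁_D`, so its
    -- Hochschild differential is `δ^D` by definition.
    exact (Q.deform D hD).opOne_lof f
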